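/- Let $U\subseteq\mathbb{R}^n$ be open, $\epsilon_0>0$, $T>0$, and let $f(t,x,\epsilon)\in\mathbb{R}^n$ be such that $f$ and its first-order partial derivatives with respect to $(x,\epsilon)$ are continuous on $[0,\infty)\times U\times[0,\epsilon_0]$ and bounded on $[0,\infty)\times U_0\times[0,\epsilon_0]$ for every compact $U_0\subset U$. Suppose $f(t+T,x,\epsilon)=f(t,x,\epsilon)$, and put $f_{av}(z)=\frac1T\int_0^T f(\tau,z,0)\,d\tau$ for $z\in U$. Suppose that the origin lies in $U$ and is an exponentially stable equilibrium point of the averaged system $\dot z=\epsilon f_{av}(z)$ on $U$, and let $\Omega\subset U$ be a compact subset of its region of attraction (by rescaling of time, neither condition depends on the value of $\epsilon>0$, so it suffices that they hold for one value). Here exponential stability means that $f_{av}(0)=0$ and that there are $c,K,\gamma>0$ such that every solution with $\|z(0)\|<c$ exists in $U$ for all $t\ge0$ and satisfies $\|z(t)\|\le K\|z(0)\|e^{-\gamma t}$; the region of attraction is the set of initial points whose solution exists in $U$ for all $t\ge 0$ and tends to $0$ as $t\to\infty$. Then there exist positive constants $k,\lambda,\delta^*,\epsilon^*,\beta_1,\beta_2,\mu$,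 with $\epsilon^*\le\epsilon_0$, such that the following holds for all $\epsilon\in(0,\epsilon^*)$, all $\delta\in(0,\delta^*)$, every continuous $g:[0,\infty)\to\mathbb{R}^n$ with $\|g(t)\|\le\delta$ for all $t\ge0$, every $x_0\in\Omega$ and every $z_0\in\mathbb{R}^n$ with $\|x_0-z_0\|\le\mu$. The initial value problems $$\dot x=\epsilon f(t,x,\epsilon)+\epsilon g(t),\quad x(0)=x_0,\qquad\qquad \dot z=\epsilon f_{av}(z),\quad z(0)=z_0,$$ have solutions with values in $U$ on all of $[0,\infty)$, and any such solutions $x$, $z$ satisfy $$\|x(t)-z(t)\|\le k e^{-\lambda\epsilon t}\|x_0-z_0\|+\beta_1\epsilon+\beta_2\delta\qquad\text{for all } t\ge0 .$$ -/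

import Mathlib

open Set Filter Topology

namespace PeriodicAveraging

variable {E : Type*} [NormedAddCommGroup E] [NormedSpace ℝ E]

/-- `x` is a solution on the whole of `[0,∞)`, with values in `U`, of the initial value problem
`x' = F(t,x)`, `x(0) = x₀` (one-sided derivative at `t = 0`). -/
structure IsSolution (U : Set E) (F : ℝ → E → E) (x₀ : E) (x : ℝ → E) : Prop where
  init : x 0 = x₀
  mem : ∀ t, 0 ≤ t → x t ∈ U
  deriv : ∀ t, 0 ≤ t → HasDerivWithinAt x (F t (x t)) (Ici 0) t

/-- The origin is an exponentially stable equilibrium point, lying in `U`, of the autonomous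
system `z' = F(z)` on `U`: solutions starting close to the origin exist for all `t ≥ 0` and satisfy
`‖z(t)‖ ≤ k ‖z(0)‖ e^{-λ t}`. -/
def IsExpStableOrigin (U : Set E) (F : E → E) : Prop :=
  (0 : E) ∈ U ∧ F 0 = 0 ∧
    ∃ c > (0 : ℝ), ∃ k > (0 : ℝ), ∃ lam > (0 : ℝ), ∀ z₀ : E, ‖z₀‖ < c →
      ∃ z : ℝ → E, IsSolution U (fun _ => F) z₀ z ∧
        ∀ t, 0 ≤ t → ‖z t‖ ≤ k * ‖z₀‖ * Real.exp (-lam * t)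

/-- The region of attraction of the origin for the autonomous system `z' = F(z)` on `U`: the
initial points whose solution exists in `U` for all `t ≥ 0` and converges to the origin. -/
def regionOfAttraction (U : Set E) (F : E → E) : Set E :=
  {z₀ | ∃ z : ℝ → E, IsSolution U (fun _ => F) z₀ z ∧ Tendsto z atTop (𝓝 0)}

/-- The averaged vector field `f_av(z) = (1/T) ∫₀ᵀ f(τ,z,0) dτ`. -/
noncomputable def averagedField (f : ℝ → E → ℝ → E) (T : ℝ) (z : E) : E :=
  (1 / T) • ∫ τ in (0 : ℝ)..T, f τ z 0

/-- `f(t,x,ε)` and its first order partial derivatives with respect to `x` and `ε` exist and are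
continuous on `[0,∞) × U × [0,ε₀]`, and are bounded on `[0,∞) × U₀ × [0,ε₀]` for every compact
`U₀ ⊆ U`. The derivative in `ε` is one-sided at the endpoints of `[0,ε₀]`. -/
def HasBoundedC1Data (U : Set E) (ε₀ : ℝ) (f : ℝ → E → ℝ → E) : Prop :=
  ∃ (fx : ℝ → E → ℝ → (E →L[ℝ] E)) (fe : ℝ → E → ℝ → E),
    (∀ t ∈ Ici (0 : ℝ), ∀ x ∈ U, ∀ ε ∈ Icc 0 ε₀,
      HasFDerivAt (fun y => f t y ε) (fx t x ε) x) ∧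
    (∀ t ∈ Ici (0 : ℝ), ∀ x ∈ U, ∀ ε ∈ Icc 0 ε₀,
      HasDerivWithinAt (fun η => f t x η) (fe t x ε) (Icc 0 ε₀) ε) ∧
    ContinuousOn (fun p : ℝ × E × ℝ => f p.1 p.2.1 p.2.2) (Ici 0 ×ˢ U ×ˢ Icc 0 ε₀) ∧
    ContinuousOn (fun p : ℝ × E × ℝ => fx p.1 p.2.1 p.2.2) (Ici 0 ×ˢ U ×ˢ Icc 0 ε₀) ∧
    ContinuousOn (fun p : ℝ × E × ℝ => fe p.1 p.2.1 p.2.2) (Ici 0 ×ˢ U ×ˢ Icc 0 ε₀) ∧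
    ∀ U₀ ⊆ U, IsCompact U₀ → ∃ M : ℝ, ∀ t ∈ Ici (0 : ℝ), ∀ x ∈ U₀, ∀ ε ∈ Icc 0 ε₀,
      ‖f t x ε‖ ≤ M ∧ ‖fx t x ε‖ ≤ M ∧ ‖fe t x ε‖ ≤ M

end PeriodicAveraging

namespace PeriodicAveraging

/-! ### Solutions on the half-line: dependence on data, uniqueness, global existence. -/

section ODE

variable {E : Type*} [NormedAddCommGroup E] [NormedSpace ℝ E]
  {U : Set E} {H : ℝ → E → E} {x₀ y₀ : E} {x y : ℝ → E}

/-! Over one period, `x` moves by `ε T f_av(x(0))` up to an error `O(ε (ε + δ))`, since `x` itself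
moves only by `O(ε)` during that period. Summing over the `O(1/ε)` periods of an interval with `ε t
≤ R`, by a discrete Gronwall inequality, gives closeness `O(ε + δ)` to the averaged solution
(`IsUniform.exists_norm_sub_le`).

To reach infinite time without a Lyapunov function, the averaged flow is shown to halve distances
near the origin after a fixed slow time (`exists_flow_contraction`). Strict differentiability of
`f_av` at `0` makes the difference of two solutions follow, approximately, the solution started at
the difference of their initial values, and exponential stability makes that one small. The slow
time is then cut into windows consisting of whole periods. On each window the finite-time error adds
`O(ε + δ)` while the contraction halves what was there, so the errors form a geometric series
(`IsUniform.exists_long_time_bound`).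

Both arguments are run for a globally bounded and Lipschitz field obtained by a cutoff
(`exists_isUniform_eqOn`). Compactness of `Ω` confines the averaged trajectories to one compact set
and gives them a common decay rate (`exists_open_uniform_decay`). The perturbed trajectory stays
near them, hence where the cutoff changes nothing, so it solves the original equation
(`exists_averaging_bound`). Local Lipschitz continuity transfers the bound to arbitrary solutions.
-/

theorem IsSolution.continuousOn (h : IsSolution U H x₀ x) : ContinuousOn x (Ici 0) :=
  fun t ht => (h.deriv t ht).continuousWithinAt

theorem IsSolution.hasDerivWithinAt_Ici (h : IsSolution U H x₀ x) {t : ℝ} (ht : 0 ≤ t) :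
    HasDerivWithinAt x (H t (x t)) (Ici t) t :=
  (h.deriv t ht).mono (Ici_subset_Ici.2 ht)

theorem IsSolution.congr_field {V : Set E} {G : ℝ → E → E} (h : IsSolution U H x₀ x)
    (hV : ∀ t, 0 ≤ t → x t ∈ V) (hG : ∀ t, 0 ≤ t → H t (x t) = G t (x t)) :
    IsSolution V G x₀ x :=
  ⟨h.init, hV, fun t ht => hG t ht ▸ h.deriv t ht⟩

theorem IsSolution.shift {a : ℝ} (ha : 0 ≤ a) (h : IsSolution U H x₀ x) :
    IsSolution U (fun t => H (t + a)) (x a) (fun t => x (t + a)) := by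
  refine ⟨by simp, fun t ht => h.mem _ (by linarith), fun t ht => ?_⟩
  have h1 := h.deriv (t + a) (by linarith)
  have h2 : HasDerivWithinAt (fun s : ℝ => s + a) 1 (Ici 0) t :=
    ((hasDerivAt_id t).add_const a).hasDerivWithinAt
  have h3 := h1.scomp t h2 (fun s hs => by simp only [mem_Ici] at hs ⊢; linarith)
  rw [one_smul] at h3
  exact h3

theorem IsSolution.rescale {F : E → E} {a : ℝ} (ha : 0 ≤ a)
    (h : IsSolution U (fun _ => F) x₀ x) :
    IsSolution U (fun _ y => a • F y) x₀ (fun t => x (a * t)) := by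
  refine ⟨by simpa using h.init, fun t ht => h.mem _ (by positivity), fun t ht => ?_⟩
  have h1 := h.deriv (a * t) (by positivity)
  have h2 : HasDerivWithinAt (fun s : ℝ => a * s) a (Ici 0) t := by
    simpa using ((hasDerivAt_id t).const_mul a).hasDerivWithinAt
  exact h1.scomp t h2 (fun s hs => by simp only [mem_Ici] at hs ⊢; positivity)

theorem IsSolution.dist_le {L : NNReal} {b : ℝ} {s : Set E}
    (hL : ∀ t, 0 ≤ t → LipschitzOnWith L (H t) s)
    (hx : IsSolution U H x₀ x) (hy : IsSolution U H y₀ y)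
    (hxs : ∀ t ∈ Icc 0 b, x t ∈ s) (hys : ∀ t ∈ Icc 0 b, y t ∈ s) (hb : 0 ≤ b) :
    dist (x b) (y b) ≤ dist x₀ y₀ * Real.exp (L * b) := by
  have := dist_le_of_trajectories_ODE_of_mem (v := H) (K := L) (s := fun _ => s) (a := 0) (b := b)
    (f := x) (g := y) (δ := dist x₀ y₀) (fun t ht => hL t ht.1)
    (hx.continuousOn.mono Icc_subset_Ici_self)
    (fun t ht => hx.hasDerivWithinAt_Ici ht.1) (fun t ht => hxs t ⟨ht.1, ht.2.le⟩)
    (hy.continuousOn.mono Icc_subset_Ici_self)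
    (fun t ht => hy.hasDerivWithinAt_Ici ht.1) (fun t ht => hys t ⟨ht.1, ht.2.le⟩)
    (by rw [hx.init, hy.init]) b ⟨hb, le_rfl⟩
  simpa using this

theorem IsSolution.norm_sub_le {L : NNReal} (hL : ∀ t, 0 ≤ t → LipschitzWith L (H t))
    (hx : IsSolution univ H x₀ x) (hy : IsSolution univ H y₀ y) {t : ℝ} (ht : 0 ≤ t) :
    ‖x t - y t‖ ≤ ‖x₀ - y₀‖ * Real.exp (L * t) := by
  simpa [dist_eq_norm] using IsSolution.dist_le (s := univ)
    (fun t ht => (hL t ht).lipschitzOnWith) hx hy (by simp) (by simp) ht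

theorem IsSolution.unique
    (hL : ∀ K ⊆ U, IsCompact K → ∃ L : NNReal, ∀ t, 0 ≤ t → LipschitzOnWith L (H t) K)
    (hx : IsSolution U H x₀ x) (hy : IsSolution U H x₀ y) {t : ℝ} (ht : 0 ≤ t) : x t = y t := by
  have hc : ∀ {z}, IsSolution U H x₀ z → IsCompact (z '' Icc 0 t) := fun hz =>
    isCompact_Icc.image_of_continuousOn (hz.continuousOn.mono Icc_subset_Ici_self)
  obtain ⟨L, hL⟩ := hL (x '' Icc 0 t ∪ y '' Icc 0 t)
    (union_subset (image_subset_iff.2 fun s hs => hx.mem s hs.1)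
      (image_subset_iff.2 fun s hs => hy.mem s hs.1)) ((hc hx).union (hc hy))
  have := IsSolution.dist_le hL hx hy (fun s hs => .inl (mem_image_of_mem x hs))
    (fun s hs => .inr (mem_image_of_mem y hs)) ht
  simpa using this

theorem IsSolution.unique_of_lipschitz {L : NNReal} (hL : ∀ t, 0 ≤ t → LipschitzWith L (H t))
    (hx : IsSolution univ H x₀ x) (hy : IsSolution univ H x₀ y) {t : ℝ} (ht : 0 ≤ t) :
    x t = y t := by
  simpa [sub_eq_zero] using IsSolution.norm_sub_le hL hx hy ht

/-- Picard–Lindelöf applies on every `[0, n]` because a bounded field cannot push a solution out of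
the ball of radius `M n`. By uniqueness the solutions are compatible and glue together. -/
theorem exists_isSolution_of_lipschitz [CompleteSpace E] {L : NNReal} {M : ℝ}
    (hL : ∀ t, 0 ≤ t → LipschitzWith L (H t)) (hM : ∀ t, 0 ≤ t → ∀ x, ‖H t x‖ ≤ M)
    (hc : ∀ x, ContinuousOn (fun t => H t x) (Ici 0)) (x₀ : E) :
    ∃ x, IsSolution univ H x₀ x := by
  have hM0 : 0 ≤ M := (norm_nonneg _).trans (hM 0 le_rfl 0)
  have key : ∀ n : ℕ, ∃ α : ℝ → E, α 0 = x₀ ∧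
      ∀ t ∈ Icc (0 : ℝ) n, HasDerivWithinAt α (H t (α t)) (Icc 0 n) t := by
    intro n
    have hP : IsPicardLindelof H (tmin := 0) (tmax := n) ⟨0, le_rfl, n.cast_nonneg⟩ x₀
        (M.toNNReal * n) 0 M.toNNReal L :=
      { lipschitzOnWith := fun t ht => (hL t ht.1).lipschitzOnWith
        continuousOn := fun x _ => (hc x).mono Icc_subset_Ici_self
        norm_le := fun t ht x _ => by simpa [hM0] using hM t ht.1 x
        mul_max_le := by simp }
    obtain ⟨α, h0, h1⟩ := hP.exists_eq_forall_mem_Icc_hasDerivWithinAt₀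
    exact ⟨α, h0, h1⟩
  choose α h0 h1 using key
  have agree : ∀ m n : ℕ, m ≤ n → EqOn (α m) (α n) (Icc 0 m) := by
    intro m n hmn
    have hmn' : (m : ℝ) ≤ n := by exact_mod_cast hmn
    have hd : ∀ k : ℕ, m ≤ k → ∀ t ∈ Ico (0 : ℝ) m,
        HasDerivWithinAt (α k) (H t (α k t)) (Ici t) t := by
      intro k hk t ht
      have hk' : (m : ℝ) ≤ k := by exact_mod_cast hk
      refine ((h1 k t ⟨ht.1, by linarith [ht.2]⟩).mono
        (s := Icc t k) (Icc_subset_Icc_left ht.1)).mono_of_mem_nhdsWithin ?_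
      exact Icc_mem_nhdsGE (by linarith [ht.2])
    have hcont : ∀ k : ℕ, m ≤ k → ContinuousOn (α k) (Icc 0 m) := fun k hk t ht =>
      ((h1 k t ⟨ht.1, ht.2.trans (by exact_mod_cast hk)⟩).continuousWithinAt).mono
        (Icc_subset_Icc_right (by exact_mod_cast hk))
    exact ODE_solution_unique_of_mem_Icc_right (v := H) (K := L) (s := fun _ => univ)
      (fun t ht => (hL t ht.1).lipschitzOnWith) (hcont m le_rfl) (hd m le_rfl)
      (fun _ _ => trivial) (hcont n hmn) (hd n hmn) (fun _ _ => trivial) (by rw [h0, h0])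
  have hval : ∀ (n : ℕ) (t : ℝ), 0 ≤ t → t ≤ n → α ⌈t⌉₊ t = α n t := fun n t ht htn =>
    agree _ _ (Nat.ceil_le.2 htn) ⟨ht, Nat.le_ceil t⟩
  refine ⟨fun t => α ⌈t⌉₊ t, by simp [h0], fun _ _ => trivial, fun t ht => ?_⟩
  obtain ⟨n, hn⟩ := exists_nat_gt t
  have h2 := h1 n t ⟨ht, hn.le⟩
  rw [← hval n t ht hn.le] at h2
  have h3 : HasDerivWithinAt (fun t => α ⌈t⌉₊ t) (H t (α ⌈t⌉₊ t)) (Icc 0 n) t :=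
    h2.congr (fun s hs => hval n s hs.1 hs.2) (hval n t ht hn.le)
  refine h3.mono_of_mem_nhdsWithin ?_
  rw [← Ici_inter_Iic]
  exact inter_mem_nhdsWithin _ (Iic_mem_nhds hn)

end ODE

/-! ### Globally uniform fields, their averages, and the cutoff. -/

section Uniform

variable {E : Type*} [NormedAddCommGroup E] [NormedSpace ℝ E]

/-- `f(t,x,ε)` is `T`-periodic and continuous in `t ≥ 0`, globally bounded, globally Lipschitz
in `x` uniformly in `(t,ε)`, and Lipschitz in `ε` at `ε = 0`. -/
structure IsUniform (f : ℝ → E → ℝ → E) (T ε₀ : ℝ) (L : NNReal) (M : ℝ) : Prop where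
  nonneg : 0 ≤ ε₀
  lip : ∀ t, 0 ≤ t → ∀ ε ∈ Icc 0 ε₀, LipschitzWith L (fun x => f t x ε)
  bound : ∀ t, 0 ≤ t → ∀ x, ∀ ε ∈ Icc 0 ε₀, ‖f t x ε‖ ≤ M
  eps : ∀ t, 0 ≤ t → ∀ x, ∀ ε ∈ Icc 0 ε₀, ‖f t x ε - f t x 0‖ ≤ M * ε
  per : ∀ t, 0 ≤ t → ∀ x, ∀ ε ∈ Icc 0 ε₀, f (t + T) x ε = f t x ε
  cont : ∀ x, ∀ ε ∈ Icc 0 ε₀, ContinuousOn (fun t => f t x ε) (Ici 0)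

variable {f : ℝ → E → ℝ → E} {T ε₀ M : ℝ} {L : NNReal}

theorem norm_average_le (hT : 0 < T) {h : ℝ → E} {C : ℝ} (hC : ∀ t ∈ Icc 0 T, ‖h t‖ ≤ C) :
    ‖(1 / T) • ∫ τ in (0 : ℝ)..T, h τ‖ ≤ C := by
  have h1 : ‖∫ τ in (0 : ℝ)..T, h τ‖ ≤ C * |T - 0| := by
    refine intervalIntegral.norm_integral_le_of_norm_le_const fun t ht => hC t ?_
    rw [uIoc_of_le hT.le] at ht
    exact ⟨ht.1.le, ht.2⟩
  rw [sub_zero, abs_of_pos hT] at h1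
  rw [norm_smul, Real.norm_of_nonneg (by positivity), div_mul_eq_mul_div, one_mul,
    div_le_iff₀ hT]
  exact h1

theorem averagedField_sub (hT : 0 < T) {a b : E}
    (ha : ContinuousOn (fun t => f t a 0) (Ici 0)) (hb : ContinuousOn (fun t => f t b 0) (Ici 0)) :
    averagedField f T a - averagedField f T b
      = (1 / T) • ∫ τ in (0 : ℝ)..T, (f τ a 0 - f τ b 0) := by
  have hi : ∀ {h : ℝ → E}, ContinuousOn h (Ici 0) → IntervalIntegrable h MeasureTheory.volume 0 T :=
    fun hh => (hh.mono (by rw [uIcc_of_le hT.le]; exact Icc_subset_Ici_self)).intervalIntegrable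
  rw [averagedField, averagedField, intervalIntegral.integral_sub (hi ha) (hi hb), smul_sub]

theorem IsUniform.averagedField_lipschitz (h : IsUniform f T ε₀ L M) (hT : 0 < T) :
    LipschitzWith L (averagedField f T) := by
  have h0 : (0 : ℝ) ∈ Icc 0 ε₀ := ⟨le_rfl, h.nonneg⟩
  refine LipschitzWith.of_dist_le_mul fun a b => ?_
  rw [dist_eq_norm, averagedField_sub hT (h.cont a 0 h0) (h.cont b 0 h0)]
  refine norm_average_le hT fun t ht => ?_
  simpa [dist_eq_norm] using (h.lip t ht.1 0 h0).dist_le_mul a b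

theorem IsUniform.averagedField_bound (h : IsUniform f T ε₀ L M) (hT : 0 < T) (x : E) :
    ‖averagedField f T x‖ ≤ M :=
  norm_average_le hT fun t ht => h.bound t ht.1 x 0 ⟨le_rfl, h.nonneg⟩

omit [NormedSpace ℝ E] in
theorem IsUniform.bound_nonneg (h : IsUniform f T ε₀ L M) : 0 ≤ M :=
  (norm_nonneg _).trans (h.bound 0 le_rfl 0 0 ⟨le_rfl, h.nonneg⟩)

omit [NormedSpace ℝ E] in
theorem IsUniform.per_nat (h : IsUniform f T ε₀ L M) (hT : 0 < T) {t ε : ℝ} (ht : 0 ≤ t) (x : E)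
    (hε : ε ∈ Icc 0 ε₀) (n : ℕ) : f (t + n * T) x ε = f t x ε := by
  induction n with
  | zero => simp
  | succ n ih =>
    rw [show t + ((n + 1 : ℕ) : ℝ) * T = t + n * T + T by push_cast; ring,
      h.per _ (by positivity) x ε hε, ih]

theorem averagedField_congr {g : ℝ → E → ℝ → E} (hT : 0 < T) {x : E}
    (h : ∀ t, 0 ≤ t → g t x 0 = f t x 0) : averagedField g T x = averagedField f T x := by
  simp only [averagedField]
  congr 1
  refine intervalIntegral.integral_congr fun t ht => h t ?_
  rw [uIcc_of_le hT.le] at ht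
  exact ht.1

theorem averagedField_const [CompleteSpace E] (hT : 0 < T) (F : E → E) :
    averagedField (fun _ x _ => F x) T = F := by
  funext x
  simp [averagedField, smul_smul, hT.ne']

theorem IsUniform.averagedField [CompleteSpace E] (h : IsUniform f T ε₀ L M) (hT : 0 < T) :
    IsUniform (fun _ x _ => averagedField f T x) T ε₀ L M where
  nonneg := h.nonneg
  lip _ _ _ _ := h.averagedField_lipschitz hT
  bound _ _ x _ _ := h.averagedField_bound hT x
  eps t _ x ε hε := by simpa using mul_nonneg h.bound_nonneg hε.1
  per _ _ _ _ _ := rfl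
  cont _ _ _ := continuousOn_const

/-- This is strict differentiability of `f_av` at the origin. The mean value inequality bounds the
remainder of `f(t,·,0)` by the oscillation of `fx` near `0`, which is small uniformly over the
compact period; averaging preserves the bound. -/
theorem exists_strict_approx_averagedField [CompleteSpace E] {U : Set E} (hU : IsOpen U)
    (h0 : (0 : E) ∈ U) (hT : 0 < T) (hε₀ : 0 ≤ ε₀) (hf : HasBoundedC1Data U ε₀ f) :
    ∃ A : E →L[ℝ] E, ∀ η > (0 : ℝ), ∃ r > (0 : ℝ), ∀ a b : E, ‖a‖ < r → ‖b‖ < r →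
      ‖averagedField f T a - averagedField f T b - A (a - b)‖ ≤ η * ‖a - b‖ := by
  obtain ⟨fx, fe, hfx, -, hfc, hfxc, -, -⟩ := hf
  have hz : (0 : ℝ) ∈ Icc 0 ε₀ := ⟨le_rfl, hε₀⟩
  have hcont : ∀ x ∈ U, ContinuousOn (fun t => f t x 0) (Ici 0) := fun x hx =>
    hfc.comp (f := fun t : ℝ => (t, x, (0 : ℝ))) (by fun_prop) fun t ht => ⟨ht, hx, hz⟩
  have hB : ContinuousOn (fun t => fx t 0 0) (Ici 0) :=
    hfxc.comp (f := fun t : ℝ => (t, (0 : E), (0 : ℝ))) (by fun_prop) fun t ht => ⟨ht, h0, hz⟩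
  have hsub : uIcc 0 T ⊆ Ici 0 := by rw [uIcc_of_le hT.le]; exact Icc_subset_Ici_self
  have hBi : IntervalIntegrable (fun t => fx t 0 0) MeasureTheory.volume 0 T :=
    (hB.mono hsub).intervalIntegrable
  refine ⟨(1 / T) • ∫ τ in (0 : ℝ)..T, fx τ 0 0, fun η hη => ?_⟩
  -- Continuity in time is known only on `[0,∞)`. Inserting `max τ 0` gives a function continuous at
  -- every real `τ`, as the compactness argument with full neighbourhoods needs, and changes nothing
  -- on `[0,T]`.
  have hev : ∀ᶠ x in 𝓝 (0 : E), ∀ τ ∈ Icc 0 T, ‖fx (max τ 0) x 0 - fx (max τ 0) 0 0‖ < η := by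
    refine isCompact_Icc.eventually_forall_of_forall_eventually fun τ _ => ?_
    have hg : ContinuousOn (fun p : E × ℝ => ‖fx (max p.2 0) p.1 0 - fx (max p.2 0) 0 0‖)
        (U ×ˢ univ) := by
      refine ContinuousOn.norm (ContinuousOn.sub ?_ ?_)
      · exact hfxc.comp (f := fun p : E × ℝ => (max p.2 0, p.1, (0 : ℝ))) (by fun_prop)
          fun p hp => ⟨le_max_right p.2 0, hp.1, hz⟩
      · exact hfxc.comp (f := fun p : E × ℝ => (max p.2 0, (0 : E), (0 : ℝ))) (by fun_prop)
          fun p hp => ⟨le_max_right p.2 0, h0, hz⟩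
    have hg' := hg.continuousAt (x := ((0 : E), τ)) ((hU.prod isOpen_univ).mem_nhds ⟨h0, trivial⟩)
    exact hg'.eventually_lt continuousAt_const (by simpa using hη)
  obtain ⟨r, hr, hball⟩ := Metric.eventually_nhds_iff_ball.1 (hev.and (hU.mem_nhds h0))
  refine ⟨r, hr, fun a b ha hb => ?_⟩
  have ha' : a ∈ Metric.ball (0 : E) r := by simpa using ha
  have hb' : b ∈ Metric.ball (0 : E) r := by simpa using hb
  have hfi : IntervalIntegrable (fun τ => f τ a 0 - f τ b 0) MeasureTheory.volume 0 T :=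
    (((hcont a (hball a ha').2).sub (hcont b (hball b hb').2)).mono hsub).intervalIntegrable
  have hBi' : IntervalIntegrable (fun τ => fx τ 0 0 (a - b)) MeasureTheory.volume 0 T :=
    ((hB.clm_apply continuousOn_const).mono hsub).intervalIntegrable
  rw [averagedField_sub hT (hcont a (hball a ha').2) (hcont b (hball b hb').2),
    smul_apply, ContinuousLinearMap.intervalIntegral_apply hBi, ← smul_sub,
    ← intervalIntegral.integral_sub hfi hBi']
  refine norm_average_le hT fun t ht => ?_
  refine (convex_ball (0 : E) r).norm_image_sub_le_of_norm_hasFDerivWithin_le'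
    (f := fun x => f t x 0) (f' := fun x => fx t x 0)
    (fun x hx => (hfx t ht.1 x (hball x hx).2 0 hz).hasFDerivWithinAt) (fun x hx => ?_) hb' ha'
  simpa [max_eq_left ht.1] using ((hball x hx).1 t ht).le

open scoped Manifold ContDiff in
theorem exists_cutoff [FiniteDimensional ℝ E] {K V : Set E} (hK : IsClosed K) (hV : IsOpen V)
    (hKV : K ⊆ V) :
    ∃ χ : E → ℝ, ContDiff ℝ ∞ χ ∧ (∀ x ∉ V, χ x = 0) ∧ (∀ x ∈ K, χ x = 1) ∧
      ∀ x, χ x ∈ Icc 0 1 := by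
  obtain ⟨χ, h0, h1, h2⟩ := exists_contMDiffMap_zero_one_of_isClosed (n := ⊤) 𝓘(ℝ, E)
    hV.isClosed_compl hK (disjoint_compl_left_iff_subset.2 hKV)
  exact ⟨χ, χ.contMDiff.contDiff, fun x hx => h0 hx, fun x hx => h1 hx, h2⟩

/-- Multiply `f` by a smooth cutoff equal to `1` on `K` and vanishing off a compact thickening of
`K` inside `U`. Bounds on that thickening become global, and the product rule gives the Lipschitz
constant `M + C * M`. -/
theorem exists_isUniform_eqOn [FiniteDimensional ℝ E] {U K : Set E} (hU : IsOpen U)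
    (hε₀ : 0 ≤ ε₀) (hf : HasBoundedC1Data U ε₀ f)
    (hper : ∀ t ∈ Ici (0 : ℝ), ∀ x ∈ U, ∀ ε ∈ Icc 0 ε₀, f (t + T) x ε = f t x ε)
    (hK : IsCompact K) (hKU : K ⊆ U) :
    ∃ (G : ℝ → E → ℝ → E) (L : NNReal) (M : ℝ), IsUniform G T ε₀ L M ∧
      ∀ t, 0 ≤ t → ∀ x ∈ K, ∀ ε ∈ Icc 0 ε₀, G t x ε = f t x ε := by
  have : ProperSpace E := FiniteDimensional.proper ℝ E
  obtain ⟨fx, fe, hfx, hfe, hfc, -, -, hbd⟩ := hf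
  obtain ⟨ρ, hρ, hρU⟩ := hK.exists_cthickening_subset_open hU hKU
  obtain ⟨χ, hχ, hχ0, hχ1, hχI⟩ := exists_cutoff hK.isClosed
    (Metric.isOpen_thickening (δ := ρ) (E := K)) (Metric.self_subset_thickening hρ K)
  have hK₂ : IsCompact (Metric.cthickening ρ K) := hK.cthickening
  have hχK₂ : ∀ x ∉ Metric.cthickening ρ K, χ x = 0 := fun x hx =>
    hχ0 x fun h => hx (Metric.thickening_subset_cthickening _ _ h)
  obtain ⟨M', hM'⟩ := hbd _ hρU hK₂
  obtain ⟨C', hC'⟩ := hK₂.exists_bound_of_continuousOn (f := fderiv ℝ χ)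
    (hχ.continuous_fderiv (by simp)).continuousOn
  set M := max M' 0
  set C := max C' 0
  have hM0 : 0 ≤ M := le_max_right _ _
  have hC0 : 0 ≤ C := le_max_right _ _
  have hM : ∀ t ∈ Ici (0 : ℝ), ∀ x ∈ Metric.cthickening ρ K, ∀ ε ∈ Icc 0 ε₀,
      ‖f t x ε‖ ≤ M ∧ ‖fx t x ε‖ ≤ M ∧ ‖fe t x ε‖ ≤ M := fun t ht x hx ε hε =>
    let h := hM' t ht x hx ε hε
    ⟨h.1.trans (le_max_left _ _), h.2.1.trans (le_max_left _ _), h.2.2.trans (le_max_left _ _)⟩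
  have hχn : ∀ x, ‖χ x‖ ≤ 1 := fun x => by
    rw [Real.norm_of_nonneg (hχI x).1]; exact (hχI x).2
  have hL0 : 0 ≤ M + C * M := by positivity
  refine ⟨fun t x ε => χ x • f t x ε, (M + C * M).toNNReal, M, ⟨hε₀, ?_, ?_, ?_, ?_, ?_⟩, ?_⟩
  · intro t ht ε hε
    have hD : ∀ x, ∃ D : E →L[ℝ] E, HasFDerivAt (fun x => χ x • f t x ε) D x ∧
        ‖D‖ ≤ M + C * M := by
      intro x
      by_cases hx : x ∈ Metric.cthickening ρ K
      · have hm := hM t ht x hx ε hε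
        refine ⟨_, ((hχ.differentiable (by simp) x).hasFDerivAt).smul
          (hfx t ht x (hρU hx) ε hε), ?_⟩
        refine (norm_add_le _ _).trans (add_le_add ?_ ?_)
        · rw [norm_smul]
          exact (mul_le_mul (hχn x) hm.2.1 (norm_nonneg _) zero_le_one).trans (one_mul M).le
        · rw [ContinuousLinearMap.norm_smulRight_apply]
          exact mul_le_mul ((hC' x hx).trans (le_max_left _ _)) hm.1 (norm_nonneg _) hC0
      · refine ⟨0, (hasFDerivAt_const (0 : E) x).congr_of_eventuallyEq ?_, by simpa using hL0⟩
        filter_upwards [Metric.isClosed_cthickening.isOpen_compl.mem_nhds hx] with y hy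
        simp [hχK₂ y hy]
    choose D hD hDn using hD
    refine LipschitzWith.of_dist_le_mul fun a b => ?_
    rw [dist_eq_norm, dist_eq_norm, Real.coe_toNNReal _ hL0]
    exact convex_univ.norm_image_sub_le_of_norm_hasFDerivWithin_le
      (fun x _ => (hD x).hasFDerivWithinAt) (fun x _ => hDn x) (mem_univ b) (mem_univ a)
  · intro t ht x ε hε
    by_cases hx : x ∈ Metric.cthickening ρ K
    · rw [norm_smul]
      exact (mul_le_mul (hχn x) (hM t ht x hx ε hε).1 (norm_nonneg _) zero_le_one).trans
        (one_mul M).le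
    · simpa [hχK₂ x hx] using hM0
  · intro t ht x ε hε
    by_cases hx : x ∈ Metric.cthickening ρ K
    · rw [← smul_sub, norm_smul]
      have h1 : ‖f t x ε - f t x 0‖ ≤ M * ‖ε - 0‖ :=
        (convex_Icc 0 ε₀).norm_image_sub_le_of_norm_hasDerivWithin_le
          (f := fun η => f t x η) (hfe t ht x (hρU hx))
          (fun η hη => (hM t ht x hx η hη).2.2) ⟨le_rfl, hε₀⟩ hε
      rw [sub_zero, Real.norm_of_nonneg hε.1] at h1
      exact (mul_le_mul (hχn x) h1 (norm_nonneg _) zero_le_one).trans (one_mul _).le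
    · simpa [hχK₂ x hx] using mul_nonneg hM0 hε.1
  · intro t ht x ε hε
    by_cases hx : x ∈ Metric.cthickening ρ K
    · simp only [hper t ht x (hρU hx) ε hε]
    · simp [hχK₂ x hx]
  · intro x ε hε
    by_cases hx : x ∈ Metric.cthickening ρ K
    · exact continuousOn_const.smul (hfc.comp (f := fun t : ℝ => (t, x, ε)) (by fun_prop)
        fun t ht => ⟨ht, hρU hx, hε⟩)
    · simp only [hχK₂ x hx, zero_smul]
      exact continuousOn_const
  · intro t _ x hx ε _
    simp [hχ1 x hx]

end Uniform

/-! ### Averaging on intervals of length `O(1/ε)`. -/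

section FiniteTime

variable {E : Type*} [NormedAddCommGroup E] [NormedSpace ℝ E]
  {f : ℝ → E → ℝ → E} {T ε₀ M : ℝ} {L : NNReal} {g : ℝ → E} {ε δ : ℝ} {x₀ z₀ : E} {x z : ℝ → E}

theorem IsUniform.norm_sub_init_le (h : IsUniform f T ε₀ L M) (hε : ε ∈ Icc 0 ε₀)
    (hg : ∀ t, 0 ≤ t → ‖g t‖ ≤ δ)
    (hx : IsSolution univ (fun t y => ε • f t y ε + ε • g t) x₀ x) {t : ℝ} (ht : 0 ≤ t) :
    ‖x t - x₀‖ ≤ ε * (M + δ) * t := by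
  have := norm_image_sub_le_of_norm_deriv_right_le_segment (f := x) (a := 0) (b := t)
    (C := ε * (M + δ)) (hx.continuousOn.mono Icc_subset_Ici_self)
    (fun s hs => hx.hasDerivWithinAt_Ici hs.1) (fun s hs => ?_) t ⟨ht, le_rfl⟩
  · simpa [hx.init] using this
  · rw [← smul_add, norm_smul, Real.norm_of_nonneg hε.1]
    exact mul_le_mul_of_nonneg_left ((norm_add_le _ _).trans
      (add_le_add (h.bound s hs.1 _ ε hε) (hg s hs.1))) hε.1

/-- Subtracting `ε ∫₀ᵗ f(s,x₀,0) ds` from `x` leaves a function whose derivative is `ε` times three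
small terms: the drift of `x` from `x₀`, the change of `ε` to `0` in `f`, and `g`. They account for
the three summands of the constant. -/
theorem IsUniform.norm_period_increment_le [CompleteSpace E] (h : IsUniform f T ε₀ L M)
    (hT : 0 < T) (hε : ε ∈ Icc 0 ε₀) (hδ : δ ≤ 1) (hg : ∀ t, 0 ≤ t → ‖g t‖ ≤ δ)
    (hx : IsSolution univ (fun t y => ε • f t y ε + ε • g t) x₀ x) :
    ‖x T - x₀ - (ε * T) • PeriodicAveraging.averagedField f T x₀‖
      ≤ ε * T * ((L * (M + 1) * T + M + 1) * (ε + δ)) := by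
  have hz : (0 : ℝ) ∈ Icc 0 ε₀ := ⟨le_rfl, h.nonneg⟩
  have hδ0 : 0 ≤ δ := (norm_nonneg _).trans (hg 0 le_rfl)
  have hM0 := h.bound_nonneg
  have hc := h.cont x₀ 0 hz
  have hI : ∀ t, 0 ≤ t → HasDerivWithinAt (fun u => ∫ s in (0 : ℝ)..u, f s x₀ 0) (f t x₀ 0)
      (Ici t) t := by
    intro t ht
    have hc' : ContinuousOn (fun s => f s x₀ 0) (Ici t) := hc.mono (Ici_subset_Ici.2 ht)
    refine intervalIntegral.integral_hasDerivWithinAt_right (t := Ioi t) ?_ ?_ ?_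
    · exact (hc.mono (by rw [uIcc_of_le ht]; exact Icc_subset_Ici_self)).intervalIntegrable
    · exact (hc'.mono Ioi_subset_Ici_self).stronglyMeasurableAtFilter_nhdsWithin
        measurableSet_Ioi t
    · exact (hc' t self_mem_Ici).mono Ioi_subset_Ici_self
  have hIc : ContinuousOn (fun u => ∫ s in (0 : ℝ)..u, f s x₀ 0) (Icc 0 T) := by
    refine intervalIntegral.continuousOn_primitive_interval' (b₁ := 0) (b₂ := T) ?_ ?_ |>.mono ?_
    · exact (hc.mono (by rw [uIcc_of_le hT.le]; exact Icc_subset_Ici_self)).intervalIntegrable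
    · exact left_mem_uIcc
    · rw [uIcc_of_le hT.le]
  have key := norm_image_sub_le_of_norm_deriv_right_le_segment
    (f := fun t => x t - ε • ∫ s in (0 : ℝ)..t, f s x₀ 0) (a := 0) (b := T)
    (f' := fun t => (ε • f t (x t) ε + ε • g t) - ε • f t x₀ 0)
    (C := ε * ((L * (M + 1) * T + M + 1) * (ε + δ)))
    ((hx.continuousOn.mono Icc_subset_Ici_self).sub (continuousOn_const.smul hIc))
    (fun s hs => (hx.hasDerivWithinAt_Ici hs.1).sub ((hI s hs.1).const_smul ε))
    (fun t ht => ?_) T ⟨hT.le, le_rfl⟩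
  · simp only [intervalIntegral.integral_same, smul_zero, sub_zero, hx.init] at key
    rw [PeriodicAveraging.averagedField, smul_smul, mul_assoc, mul_one_div_cancel hT.ne', mul_one,
      sub_right_comm]
    exact key.trans (le_of_eq (by ring))
  · have h1 : ‖f t (x t) ε - f t x₀ ε‖ ≤ L * (ε * (M + 1) * T) := by
      have h2 := (h.lip t ht.1 ε hε).dist_le_mul (x t) x₀
      rw [dist_eq_norm, dist_eq_norm] at h2
      refine h2.trans (mul_le_mul_of_nonneg_left ?_ L.2)
      refine (h.norm_sub_init_le hε hg hx ht.1).trans ?_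
      have := hε.1
      have := ht.1
      have := ht.2.le
      gcongr
    have h2 := h.eps t ht.1 x₀ ε hε
    have h3 := hg t ht.1
    have h4 : (ε • f t (x t) ε + ε • g t) - ε • f t x₀ 0
        = ε • ((f t (x t) ε - f t x₀ ε) + (f t x₀ ε - f t x₀ 0) + g t) := by
      simp only [smul_sub, smul_add]
      abel
    rw [h4, norm_smul, Real.norm_of_nonneg hε.1]
    refine mul_le_mul_of_nonneg_left ?_ hε.1
    refine (norm_add_le _ _).trans ((add_le_add (norm_add_le _ _) le_rfl).trans ?_)
    have h5 : 0 ≤ L * (M + 1) * T * δ := by have := L.2; positivity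
    have h6 : 0 ≤ M * δ := by positivity
    linarith [hε.1]

theorem IsUniform.shift_periods (h : IsUniform f T ε₀ L M) (hT : 0 < T) (hε : ε ∈ Icc 0 ε₀)
    (hx : IsSolution univ (fun t y => ε • f t y ε + ε • g t) x₀ x) (n : ℕ) :
    IsSolution univ (fun t y => ε • f t y ε + ε • g (t + n * T)) (x (n * T))
      (fun t => x (t + n * T)) :=
  (hx.shift (a := n * T) (by positivity)).congr_field (fun _ _ => trivial) fun t ht => by
    simp only [h.per_nat hT ht _ hε n]

theorem le_exp_mul_of_le_succ {d : ℕ → ℝ} {a b : ℝ} (ha : 0 ≤ a) (hb : 0 ≤ b) (hd0 : 0 ≤ d 0)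
    (hd : ∀ n, d (n + 1) ≤ (1 + a) * d n + b) (n : ℕ) :
    d n ≤ Real.exp (a * n) * (d 0 + n * b) := by
  induction n with
  | zero => simp
  | succ n ih =>
    have h1 : 1 + a ≤ Real.exp a := by linarith [Real.add_one_le_exp a]
    have h2 : Real.exp (a * (n + 1 : ℕ)) = Real.exp a * Real.exp (a * n) := by
      rw [← Real.exp_add]; push_cast; ring_nf
    have h3 : 1 ≤ Real.exp (a * (n + 1 : ℕ)) := Real.one_le_exp (by positivity)
    have h4 : 0 ≤ Real.exp (a * n) * (d 0 + n * b) := by positivity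
    calc d (n + 1) ≤ (1 + a) * d n + b := hd n
      _ ≤ (1 + a) * (Real.exp (a * n) * (d 0 + n * b)) + b := by gcongr
      _ ≤ Real.exp a * (Real.exp (a * n) * (d 0 + n * b)) + Real.exp (a * (n + 1 : ℕ)) * b :=
        add_le_add (mul_le_mul_of_nonneg_right h1 h4) (le_mul_of_one_le_left hb h3)
      _ = Real.exp (a * (n + 1 : ℕ)) * (d 0 + (n + 1 : ℕ) * b) := by
        rw [h2]; push_cast; ring

/-- Finite-time averaging: on time intervals of length `R / ε` the perturbed system stays
`O(ε + δ)`-close to the averaged system. -/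
theorem IsUniform.exists_norm_sub_le [CompleteSpace E] (h : IsUniform f T ε₀ L M) (hT : 0 < T)
    {R : ℝ} (hR : 0 ≤ R) :
    ∃ C > (0 : ℝ), ∀ (ε δ : ℝ) (g : ℝ → E) (x₀ z₀ : E) (x z : ℝ → E), ε ∈ Icc 0 ε₀ → δ ≤ 1 →
      (∀ t, 0 ≤ t → ‖g t‖ ≤ δ) →
      IsSolution univ (fun t y => ε • f t y ε + ε • g t) x₀ x →
      IsSolution univ (fun _ y => ε • PeriodicAveraging.averagedField f T y) z₀ z →
      ∀ t, 0 ≤ t → ε * t ≤ R →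
        ‖x t - z t‖ ≤ Real.exp (L * R) * ‖x₀ - z₀‖ + C * (ε + δ) := by
  have hM0 := h.bound_nonneg
  set C₀ : ℝ := L * (M + 1) * T + M + 1
  have hC₀ : 0 < C₀ := by have := L.2; positivity
  refine ⟨Real.exp (L * R) * (R * (2 * C₀)) + 2 * (M + 1) * T, by positivity, ?_⟩
  intro ε δ g x₀ z₀ x z hε hδ hg hx hz t ht htR
  have hδ0 : 0 ≤ δ := (norm_nonneg _).trans (hg 0 le_rfl)
  have hε0 := hε.1
  have hF := h.averagedField hT
  -- The averaged field is its own average, so the one-period estimate also applies to `z`, with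
  -- zero perturbation.
  have hz' : IsSolution univ (fun t y => ε • (fun _ x _ => PeriodicAveraging.averagedField f T x :
      ℝ → E → ℝ → E) t y ε + ε • (0 : ℝ → E) t) z₀ z := by simpa using hz
  have hxn := fun n : ℕ => h.shift_periods hT hε hx n
  have hzn := fun n : ℕ => hF.shift_periods hT hε hz' n
  have hgn : ∀ n : ℕ, ∀ t, 0 ≤ t → ‖g (t + n * T)‖ ≤ δ := fun n t ht => hg _ (by positivity)
  have hg0 : ∀ n : ℕ, ∀ t, 0 ≤ t → ‖(0 : ℝ → E) (t + n * T)‖ ≤ 0 := by simp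
  set d : ℕ → ℝ := fun n => ‖x (n * T) - z (n * T)‖
  have hd : ∀ n, d (n + 1) ≤ (1 + ε * T * L) * d n + ε * T * (2 * C₀ * (ε + δ)) := by
    intro n
    have h1 := h.norm_period_increment_le hT hε hδ (hgn n) (hxn n)
    have h2 := hF.norm_period_increment_le hT hε zero_le_one (hg0 n) (hzn n)
    rw [averagedField_const hT] at h2
    have h3 := (h.averagedField_lipschitz hT).dist_le_mul (x (n * T)) (z (n * T))
    rw [dist_eq_norm, dist_eq_norm] at h3
    have e : T + n * T = (n + 1 : ℕ) * T := by push_cast; ring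
    simp only [e] at h1 h2
    have h4 : x ((n + 1 : ℕ) * T) - z ((n + 1 : ℕ) * T)
        = (x (n * T) - z (n * T))
          + (ε * T) • (PeriodicAveraging.averagedField f T (x (n * T))
            - PeriodicAveraging.averagedField f T (z (n * T)))
          + (x ((n + 1 : ℕ) * T) - x (n * T)
            - (ε * T) • PeriodicAveraging.averagedField f T (x (n * T)))
          - (z ((n + 1 : ℕ) * T) - z (n * T)
            - (ε * T) • PeriodicAveraging.averagedField f T (z (n * T))) := by
      rw [smul_sub]; abel
    have h5 : ‖(ε * T) • (PeriodicAveraging.averagedField f T (x (n * T))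
            - PeriodicAveraging.averagedField f T (z (n * T)))‖ ≤ ε * T * (L * d n) := by
      rw [norm_smul, Real.norm_of_nonneg (by positivity)]
      exact mul_le_mul_of_nonneg_left h3 (by positivity)
    have h6 : ε * T * (C₀ * (ε + 0)) ≤ ε * T * (C₀ * (ε + δ)) := by gcongr
    calc d (n + 1) = _ := congrArg norm h4
      _ ≤ d n + ε * T * (L * d n) + ε * T * (C₀ * (ε + δ)) + ε * T * (C₀ * (ε + 0)) :=
        (_root_.norm_sub_le _ _).trans (add_le_add ((norm_add_le _ _).trans
          (add_le_add ((norm_add_le _ _).trans (add_le_add le_rfl h5)) h1)) h2)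
      _ ≤ _ := by linarith
  -- At most `R / (ε T)` complete periods fit before `t`, so the increments of size `ε T · 2 C₀ (ε +
  -- δ)` sum to at most `R · 2 C₀ (ε + δ)`. The incomplete last period costs `O(ε)`.
  set n := ⌊t / T⌋₊
  have hn1 : n * T ≤ t := (le_div_iff₀ hT).1 (Nat.floor_le (by positivity))
  have hn2 : t - n * T ≤ T := by
    have := (div_lt_iff₀ hT).1 (Nat.lt_floor_add_one (t / T))
    linarith
  have hdn := le_exp_mul_of_le_succ (d := d) (a := ε * T * L) (b := ε * T * (2 * C₀ * (ε + δ)))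
    (by have := L.2; positivity) (by positivity) (norm_nonneg _) hd n
  have hnR : ε * (n * T) ≤ R := (mul_le_mul_of_nonneg_left hn1 hε0).trans htR
  have hd0 : d 0 = ‖x₀ - z₀‖ := by simp [d, hx.init, hz.init]
  have hdn' : d n ≤ Real.exp (L * R) * (‖x₀ - z₀‖ + R * (2 * C₀ * (ε + δ))) := by
    refine hdn.trans ?_
    rw [hd0]
    have e1 : ε * T * L * n ≤ L * R := by
      calc ε * T * L * n = L * (ε * (n * T)) := by ring
        _ ≤ _ := mul_le_mul_of_nonneg_left hnR L.2
    have e2 : n * (ε * T * (2 * C₀ * (ε + δ))) ≤ R * (2 * C₀ * (ε + δ)) := by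
      calc n * (ε * T * (2 * C₀ * (ε + δ))) = (ε * (n * T)) * (2 * C₀ * (ε + δ)) := by ring
        _ ≤ _ := mul_le_mul_of_nonneg_right hnR (by positivity)
    gcongr
  have hs : 0 ≤ t - n * T := by linarith
  have b1 := h.norm_sub_init_le hε (hgn n) (hxn n) hs
  have b2 := hF.norm_sub_init_le hε (hg0 n) (hzn n) hs
  simp only [sub_add_cancel] at b1 b2
  have b1' : ‖x t - x (n * T)‖ ≤ ε * (M + 1) * T := b1.trans (by gcongr)
  have b2' : ‖z t - z (n * T)‖ ≤ ε * (M + 1) * T := b2.trans (by gcongr; exact zero_le_one)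
  have h7 : x t - z t = (x t - x (n * T)) - (z t - z (n * T)) + (x (n * T) - z (n * T)) := by abel
  have h8 : 0 ≤ 2 * (M + 1) * T * δ := by positivity
  calc ‖x t - z t‖ = _ := congrArg norm h7
    _ ≤ ε * (M + 1) * T + ε * (M + 1) * T
        + Real.exp (L * R) * (‖x₀ - z₀‖ + R * (2 * C₀ * (ε + δ))) :=
      (norm_add_le _ _).trans (add_le_add ((_root_.norm_sub_le _ _).trans (add_le_add b1' b2')) hdn')
    _ ≤ _ := by linarith

end FiniteTime

/-! ### Contraction of the averaged flow near the origin. -/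

section Contraction

variable {E : Type*} [NormedAddCommGroup E] [NormedSpace ℝ E] {F : E → E} {L : NNReal} {M : ℝ}

/-- If the origin is exponentially stable and the vector field is strictly differentiable there,
then the flow is eventually a contraction near the origin. -/
theorem exists_flow_contraction [CompleteSpace E] (hL : LipschitzWith L F)
    (hM : ∀ x, ‖F x‖ ≤ M) (hF0 : F 0 = 0) {A : E →L[ℝ] E}
    (hA : ∀ η > (0 : ℝ), ∃ r > (0 : ℝ), ∀ a b : E, ‖a‖ < r → ‖b‖ < r →
      ‖F a - F b - A (a - b)‖ ≤ η * ‖a - b‖)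
    {c K γ T : ℝ} (hc : 0 < c) (hK : 0 < K) (hγ : 0 < γ) (hT : 0 < T)
    (hdecay : ∀ p z, ‖p‖ < c → IsSolution univ (fun _ => F) p z →
      ∀ t, 0 ≤ t → ‖z t‖ ≤ K * ‖p‖ * Real.exp (-γ * t)) :
    ∃ S > (0 : ℝ), ∃ r > (0 : ℝ), ∀ p q y z, ‖p‖ < r → ‖q‖ < r →
      IsSolution univ (fun _ => F) p y → IsSolution univ (fun _ => F) q z →
      ∀ t ∈ Icc S (S + T), ‖y t - z t‖ ≤ 1 / 2 * ‖p - q‖ := by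
  -- For `t ≥ S`, `exp (γ t) ≥ γ t ≥ 4 K`, so the decay estimate yields a factor `1/4`.
  set S : ℝ := 4 * K / γ with hSdef
  have hS : 0 < S := by positivity
  set R : ℝ := S + T
  have hR : 0 < R := by positivity
  set Q : ℝ := Real.exp (L * R) with hQ
  set a : ℝ := ‖A‖ + 1
  have ha : 1 ≤ a := by simp [a]
  -- Chosen so that the Gronwall error `2 η Q exp (a R) ‖v‖` below is exactly the other quarter of
  -- `‖v‖`.
  set η : ℝ := (8 * Q * Real.exp (a * R))⁻¹ with hη
  have hη0 : 0 < η := by positivity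
  obtain ⟨r', hr', hAr⟩ := hA η hη0
  have hL' : ∀ t : ℝ, 0 ≤ t → LipschitzWith L ((fun _ => F : ℝ → E → E) t) := fun _ _ => hL
  -- The halved radii ensure that `p - q` too starts in the decay ball. Growth by at most `Q` then
  -- keeps all three trajectories within `r'` up to time `R`.
  refine ⟨S, hS, min (c / 2) (r' / (4 * Q)), by positivity, ?_⟩
  intro p q y z hp hq hy hz t ht
  have ht0 : 0 ≤ t := hS.le.trans ht.1
  set v := p - q with hv
  have hpq : ‖v‖ < min c (r' / (2 * Q)) := by
    have h1 : ‖v‖ ≤ ‖p‖ + ‖q‖ := norm_sub_le _ _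
    refine lt_min ?_ ?_
    · linarith [hp.trans_le (min_le_left _ _), hq.trans_le (min_le_left _ _)]
    · have : r' / (2 * Q) = r' / (4 * Q) + r' / (4 * Q) := by field_simp; norm_num
      linarith [hp.trans_le (min_le_right _ _), hq.trans_le (min_le_right _ _)]
  obtain ⟨w, hw⟩ := exists_isSolution_of_lipschitz (H := fun _ => F) hL' (fun _ _ => hM)
    (fun _ => continuousOn_const) v
  have hzero : IsSolution univ (fun _ => F) (0 : E) (fun _ : ℝ => (0 : E)) :=
    ⟨rfl, fun _ _ => trivial, fun s _ => by simpa [hF0] using hasDerivWithinAt_const s (Ici 0) (0 : E)⟩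
  have hexp : ∀ s ∈ Icc 0 R, Real.exp (L * s) ≤ Q := fun s hs =>
    Real.exp_le_exp.2 (mul_le_mul_of_nonneg_left hs.2 L.2)
  have grow : ∀ {p₁ p₂ : E} {y₁ y₂ : ℝ → E}, IsSolution univ (fun _ => F) p₁ y₁ →
      IsSolution univ (fun _ => F) p₂ y₂ → ∀ s ∈ Icc 0 R, ‖y₁ s - y₂ s‖ ≤ ‖p₁ - p₂‖ * Q :=
    fun h₁ h₂ s hs => (IsSolution.norm_sub_le hL' h₁ h₂ hs.1).trans
      (mul_le_mul_of_nonneg_left (hexp s hs) (norm_nonneg _))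
  have small : ∀ {p₁ : E} {y₁ : ℝ → E}, IsSolution univ (fun _ => F) p₁ y₁ →
      ‖p₁‖ < r' / (2 * Q) → ∀ s ∈ Icc 0 R, ‖y₁ s‖ < r' := by
    intro p₁ y₁ h₁ hp₁ s hs
    have h2 := grow h₁ hzero s hs
    simp only [sub_zero] at h2
    have h3 : ‖p₁‖ * (2 * Q) < r' := (lt_div_iff₀ (by positivity)).1 hp₁
    have h4 : 0 ≤ ‖p₁‖ * Q := by positivity
    linarith
  have hle : r' / (4 * Q) ≤ r' / (2 * Q) := by gcongr; norm_num
  have sy := small hy ((hp.trans_le (min_le_right _ _)).trans_le hle)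
  have sz := small hz ((hq.trans_le (min_le_right _ _)).trans_le hle)
  have sw := small hw (hpq.trans_le (min_le_right _ _))
  have htR : t ∈ Icc 0 R := ⟨ht0, ht.2⟩
  -- Both `y - z` and `w` satisfy the equation with matrix `A` up to an error `η ‖v‖ Q`, and they
  -- start at the same point.
  have hgr := norm_le_gronwallBound_of_norm_deriv_right_le (f := fun s => y s - z s - w s)
    (f' := fun s => F (y s) - F (z s) - F (w s)) (δ := 0) (K := a) (ε := 2 * η * (‖v‖ * Q))
    (a := 0) (b := R)
    (((hy.continuousOn.sub hz.continuousOn).sub hw.continuousOn).mono Icc_subset_Ici_self)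
    (fun s hs => ((hy.hasDerivWithinAt_Ici hs.1).sub (hz.hasDerivWithinAt_Ici hs.1)).sub
      (hw.hasDerivWithinAt_Ici hs.1))
    (by simp [hy.init, hz.init, hw.init, hv]) (fun s hs => ?_) t htR
  · rw [gronwallBound_of_K_ne_0 (by positivity)] at hgr
    simp only [zero_mul, zero_add, sub_zero] at hgr
    have h1 : 2 * η * (‖v‖ * Q) / a * (Real.exp (a * t) - 1) ≤ 1 / 4 * ‖v‖ := by
      have e1 : Real.exp (a * t) - 1 ≤ Real.exp (a * R) := by
        have : Real.exp (a * t) ≤ Real.exp (a * R) := by gcongr; exact ht.2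
        linarith
      calc 2 * η * (‖v‖ * Q) / a * (Real.exp (a * t) - 1)
          ≤ 2 * η * (‖v‖ * Q) / a * Real.exp (a * R) := by gcongr
        _ ≤ 2 * η * (‖v‖ * Q) * Real.exp (a * R) := by
          gcongr; exact div_le_self (by positivity) ha
        _ = 1 / 4 * ‖v‖ := by 
          have hQ0 : Q ≠ 0 := (Real.exp_pos _).ne'
          have he0 : Real.exp (a * R) ≠ 0 := (Real.exp_pos _).ne'
          rw [hη]
          field_simp
          ring
    have h2 : ‖w t‖ ≤ 1 / 4 * ‖v‖ := by
      refine (hdecay v w (hpq.trans_le (min_le_left _ _)) hw t ht0).trans ?_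
      have e2 : 4 * K ≤ Real.exp (γ * t) := by
        have e3 : 4 * K ≤ γ * t := by
          have := ht.1
          rw [hSdef, div_le_iff₀ hγ] at this
          linarith
        linarith [Real.add_one_le_exp (γ * t)]
      have e4 : K * Real.exp (-γ * t) ≤ 1 / 4 := by
        rw [neg_mul, Real.exp_neg, ← div_eq_mul_inv, div_le_iff₀ (Real.exp_pos _)]
        linarith
      calc K * ‖v‖ * Real.exp (-γ * t) = K * Real.exp (-γ * t) * ‖v‖ := by ring
        _ ≤ _ := by gcongr
    calc ‖y t - z t‖ = ‖(y t - z t - w t) + w t‖ := by rw [sub_add_cancel]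
      _ ≤ 1 / 4 * ‖v‖ + 1 / 4 * ‖v‖ := (norm_add_le _ _).trans (add_le_add (hgr.trans h1) h2)
      _ = _ := by ring
  · have hs' : s ∈ Icc 0 R := ⟨hs.1, hs.2.le⟩
    have b1 := (hAr _ _ (sy s hs') (sz s hs')).trans
      (mul_le_mul_of_nonneg_left (grow hy hz s hs') hη0.le)
    have b2 := hAr (w s) 0 (sw s hs') (by simpa using hr')
    have b3 := grow hw hzero s hs'
    simp only [hF0, sub_zero] at b2 b3
    replace b2 := b2.trans (mul_le_mul_of_nonneg_left b3 hη0.le)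
    have e : F (y s) - F (z s) - F (w s) = A (y s - z s - w s)
        + (F (y s) - F (z s) - A (y s - z s)) - (F (w s) - A (w s)) := by
      rw [map_sub A (y s - z s)]; abel
    have b4 : ‖A (y s - z s - w s)‖ ≤ a * ‖y s - z s - w s‖ :=
      (A.le_opNorm _).trans (mul_le_mul_of_nonneg_right (by simp [a]) (norm_nonneg _))
    rw [e]
    refine (norm_sub_le _ _).trans ((add_le_add ((norm_add_le _ _).trans
      (add_le_add b4 b1)) b2).trans (le_of_eq ?_))
    ring

end Contraction

/-! ### Uniform decay from a neighbourhood of `Ω`. -/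

section Attraction

variable {E : Type*} [NormedAddCommGroup E] [NormedSpace ℝ E] {F : E → E} {U : Set E}

theorem IsExpStableOrigin.of_smul {a : ℝ} (ha : 0 < a)
    (h : IsExpStableOrigin U (fun z => a • F z)) : IsExpStableOrigin U F := by
  obtain ⟨h0, hF, c, hc, k, hk, lam, hl, hz⟩ := h
  refine ⟨h0, (smul_eq_zero.1 hF).resolve_left ha.ne', c, hc, k, hk, lam * a⁻¹, by positivity,
    fun z₀ hz₀ => ?_⟩
  obtain ⟨z, hz1, hz2⟩ := hz z₀ hz₀
  refine ⟨_, by simpa [smul_smul, ha.ne'] using hz1.rescale (a := a⁻¹) (by positivity),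
    fun t ht => ?_⟩
  have := hz2 (a⁻¹ * t) (by positivity)
  rwa [show -lam * (a⁻¹ * t) = -(lam * a⁻¹) * t by ring] at this

theorem regionOfAttraction_smul_subset {a : ℝ} (ha : 0 < a) :
    regionOfAttraction U (fun z => a • F z) ⊆ regionOfAttraction U F := by
  rintro z₀ ⟨z, hz, hlim⟩
  refine ⟨_, by simpa [smul_smul, ha.ne'] using hz.rescale (a := a⁻¹) (by positivity), ?_⟩
  exact hlim.comp (tendsto_id.const_mul_atTop (by positivity))

/-- Near a point of the region of attraction all solutions stay in a common compact set and decay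
exponentially at a common rate. -/
theorem exists_ball_uniform_decay [ProperSpace E] (hU : IsOpen U) (h0 : (0 : E) ∈ U)
    (hext : ∀ K ⊆ U, IsCompact K → ∃ (G : E → E) (L : NNReal) (M : ℝ),
      LipschitzWith L G ∧ (∀ x, ‖G x‖ ≤ M) ∧ EqOn G F K)
    {c k γ : ℝ} (hc : 0 < c) (hk : 0 < k) (hγ : 0 < γ)
    (hstab : ∀ z₀ : E, ‖z₀‖ < c → ∃ z : ℝ → E, IsSolution U (fun _ => F) z₀ z ∧
        ∀ t, 0 ≤ t → ‖z t‖ ≤ k * ‖z₀‖ * Real.exp (-γ * t))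
    {p : E} (hp : p ∈ regionOfAttraction U F) :
    ∃ ρ > (0 : ℝ), ∃ K ⊆ U, IsCompact K ∧ ∃ C : ℝ, ∀ q ∈ Metric.ball p ρ,
      ∃ z, IsSolution U (fun _ => F) q z ∧ (∀ t, 0 ≤ t → z t ∈ K) ∧
        ∀ t, 0 ≤ t → ‖z t‖ ≤ C * Real.exp (-γ * t) := by
  obtain ⟨zp, hzp, hlim⟩ := hp
  obtain ⟨r₁, hr₁, hball⟩ := Metric.nhds_basis_closedBall.mem_iff.1 (hU.mem_nhds h0)
  -- The bound `k c' ≤ r₁` keeps solutions starting in the `c'`-ball inside the closed `r₁`-ball,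
  -- which lies in `U`.
  set c' := min (min c r₁) (r₁ / k)
  have hc' : 0 < c' := by positivity
  have hc'c : c' ≤ c := (min_le_left _ _).trans (min_le_left _ _)
  have hc'r : c' ≤ r₁ := (min_le_left _ _).trans (min_le_right _ _)
  have hkc : k * c' ≤ r₁ := by
    have := (le_div_iff₀ hk).1 (min_le_right (min c r₁) (r₁ / k))
    linarith
  obtain ⟨S₀, hS₀⟩ := (hlim.eventually (Metric.ball_mem_nhds 0 (half_pos hc'))).exists_forall_of_atTop
  set S := max S₀ 0
  have hS : 0 ≤ S := le_max_right _ _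
  have hzS : ∀ t, S ≤ t → ‖zp t‖ < c' / 2 := fun t ht => by
    simpa using hS₀ t ((le_max_left _ _).trans ht)
  have hK' : IsCompact (zp '' Icc 0 S) :=
    isCompact_Icc.image_of_continuousOn (hzp.continuousOn.mono Icc_subset_Ici_self)
  obtain ⟨d, hd, hdU⟩ := hK'.exists_cthickening_subset_open hU
    (image_subset_iff.2 fun s hs => hzp.mem s hs.1)
  set K := Metric.cthickening d (zp '' Icc 0 S) ∪ Metric.closedBall 0 r₁
  have hKU : K ⊆ U := union_subset hdU hball
  have hK : IsCompact K := hK'.cthickening.union (isCompact_closedBall 0 r₁)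
  obtain ⟨G, L, M, hGL, hGM, hGF⟩ := hext K hKU hK
  have hL' : ∀ t : ℝ, 0 ≤ t → LipschitzWith L ((fun _ => G : ℝ → E → E) t) := fun _ _ => hGL
  obtain ⟨B, hB⟩ := hK.isBounded.exists_norm_le
  have hzG : IsSolution univ (fun _ => G) p zp := by
    refine hzp.congr_field (fun _ _ => trivial) fun t ht => (hGF ?_).symm
    rcases le_total t S with h | h
    · exact .inl (Metric.self_subset_cthickening _ (mem_image_of_mem zp ⟨ht, h⟩))
    · refine .inr ?_
      simp only [Metric.mem_closedBall, dist_zero_right]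
      linarith [hzS t h]
  -- The factor `exp (-(L S))` absorbs the spreading of trajectories on `[0,S]`: they stay `d`-close
  -- to `zp` and enter the `c'`-ball at time `S`. The factor `exp (γ S)` covers the time before `S`
  -- and the later start of the decay.
  refine ⟨min d (c' / 2) * Real.exp (-(L * S)), by positivity, K, hKU, hK,
    (max B 0 + k * c') * Real.exp (γ * S), fun q hq => ?_⟩
  obtain ⟨w, hw⟩ := exists_isSolution_of_lipschitz (H := fun _ => G) hL' (fun _ _ => hGM)
    (fun _ => continuousOn_const) q
  have hclose : ∀ t ∈ Icc 0 S, ‖w t - zp t‖ ≤ min d (c' / 2) := by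
    intro t ht
    refine (IsSolution.norm_sub_le hL' hw hzG ht.1).trans ?_
    rw [Metric.mem_ball, dist_eq_norm] at hq
    calc ‖q - p‖ * Real.exp (L * t)
        ≤ min d (c' / 2) * Real.exp (-(L * S)) * Real.exp (L * S) := by
          gcongr; exact ht.2
      _ = min d (c' / 2) := by rw [mul_assoc, ← Real.exp_add]; simp
  have hwS : ‖w S‖ < c' := by
    have h1 := (hclose S ⟨hS, le_rfl⟩).trans (min_le_right _ _)
    have h2 := hzS S le_rfl
    have h3 := norm_sub_norm_le (w S) (zp S)
    linarith
  obtain ⟨ζ, hζ, hζd⟩ := hstab (w S) (hwS.trans_le hc'c)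
  have hζd' : ∀ t, 0 ≤ t → ‖ζ t‖ ≤ k * c' * Real.exp (-γ * t) := fun t ht =>
    (hζd t ht).trans (by gcongr)
  have hζb : ∀ t, 0 ≤ t → ζ t ∈ Metric.closedBall (0 : E) r₁ := fun t ht => by
    rw [Metric.mem_closedBall, dist_zero_right]
    refine (hζd' t ht).trans (le_trans ?_ hkc)
    exact mul_le_of_le_one_right (by positivity)
      (Real.exp_le_one_iff.2 (by rw [neg_mul]; exact neg_nonpos.2 (by positivity)))
  have hζG : IsSolution univ (fun _ => G) (w S) ζ :=
    hζ.congr_field (fun _ _ => trivial) fun t ht => (hGF (.inr (hζb t ht))).symm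
  have heq : ∀ t, S ≤ t → w t = ζ (t - S) := fun t ht => by
    have := IsSolution.unique_of_lipschitz hL' (hw.shift hS) hζG (t := t - S) (by linarith)
    simpa using this
  have hwK : ∀ t, 0 ≤ t → w t ∈ K := by
    intro t ht
    rcases le_total t S with h | h
    · refine .inl (Metric.mem_cthickening_of_dist_le _ (zp t) _ _ (mem_image_of_mem zp ⟨ht, h⟩) ?_)
      rw [dist_eq_norm]
      exact (hclose t ⟨ht, h⟩).trans (min_le_left _ _)
    · rw [heq t h]
      exact .inr (hζb _ (by linarith))
  refine ⟨w, hw.congr_field (fun t ht => hKU (hwK t ht)) fun t ht => hGF (hwK t ht), hwK,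
    fun t ht => ?_⟩
  have hkc0 : 0 ≤ k * c' := by positivity
  have hB0 : 0 ≤ max B 0 := le_max_right _ _
  rw [mul_assoc, ← Real.exp_add]
  rcases le_total t S with h | h
  · have h1 : 1 ≤ Real.exp (γ * S + -γ * t) :=
      Real.one_le_exp (by have := mul_le_mul_of_nonneg_left h hγ.le; linarith)
    calc ‖w t‖ ≤ max B 0 + k * c' := by
          linarith [hB _ (hwK t ht), le_max_left B 0]
      _ ≤ _ := le_mul_of_one_le_right (by positivity) h1
  · rw [heq t h]
    refine (hζd' _ (by linarith)).trans ?_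
    rw [show γ * S + -γ * t = -γ * (t - S) by ring]
    exact mul_le_mul_of_nonneg_right (by linarith) (Real.exp_pos _).le

theorem exists_open_uniform_decay [ProperSpace E] (hU : IsOpen U) (h0 : (0 : E) ∈ U)
    (hext : ∀ K ⊆ U, IsCompact K → ∃ (G : E → E) (L : NNReal) (M : ℝ),
      LipschitzWith L G ∧ (∀ x, ‖G x‖ ≤ M) ∧ EqOn G F K)
    {c k γ : ℝ} (hc : 0 < c) (hk : 0 < k) (hγ : 0 < γ)
    (hstab : ∀ z₀ : E, ‖z₀‖ < c → ∃ z : ℝ → E, IsSolution U (fun _ => F) z₀ z ∧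
        ∀ t, 0 ≤ t → ‖z t‖ ≤ k * ‖z₀‖ * Real.exp (-γ * t))
    {Ω : Set E} (hΩ : IsCompact Ω) (hΩattr : Ω ⊆ regionOfAttraction U F) :
    ∃ O, IsOpen O ∧ Ω ⊆ O ∧ ∃ K ⊆ U, IsCompact K ∧ ∃ C : ℝ, ∀ q ∈ O,
      ∃ z, IsSolution U (fun _ => F) q z ∧ (∀ t, 0 ≤ t → z t ∈ K) ∧
        ∀ t, 0 ≤ t → ‖z t‖ ≤ C * Real.exp (-γ * t) := by
  refine hΩ.induction_on (p := fun s => ∃ O, IsOpen O ∧ s ⊆ O ∧ ∃ K ⊆ U, IsCompact K ∧ ∃ C : ℝ,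
    ∀ q ∈ O, ∃ z, IsSolution U (fun _ => F) q z ∧ (∀ t, 0 ≤ t → z t ∈ K) ∧
        ∀ t, 0 ≤ t → ‖z t‖ ≤ C * Real.exp (-γ * t)) ?_ ?_ ?_ ?_
  · exact ⟨∅, isOpen_empty, le_rfl, ∅, empty_subset _, isCompact_empty, 0, by simp⟩
  · rintro s t hst ⟨O, hO, htO, h⟩
    exact ⟨O, hO, hst.trans htO, h⟩
  · rintro s t ⟨O, hO, hsO, K, hKU, hK, C, h⟩ ⟨O', hO', htO', K', hKU', hK', C', h'⟩
    refine ⟨O ∪ O', hO.union hO', union_subset_union hsO htO', K ∪ K', union_subset hKU hKU',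
      hK.union hK', max C C', ?_⟩
    rintro q (hq | hq)
    · obtain ⟨z, hz, hzK, hzC⟩ := h q hq
      exact ⟨z, hz, fun t ht => .inl (hzK t ht), fun t ht => (hzC t ht).trans
        (mul_le_mul_of_nonneg_right (le_max_left _ _) (Real.exp_pos _).le)⟩
    · obtain ⟨z, hz, hzK, hzC⟩ := h' q hq
      exact ⟨z, hz, fun t ht => .inr (hzK t ht), fun t ht => (hzC t ht).trans
        (mul_le_mul_of_nonneg_right (le_max_right _ _) (Real.exp_pos _).le)⟩
  · intro p hp
    obtain ⟨ρ, hρ, h⟩ := exists_ball_uniform_decay hU h0 hext hc hk hγ hstab (hΩattr hp)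
    exact ⟨Metric.ball p ρ, mem_nhdsWithin_of_mem_nhds (Metric.ball_mem_nhds p hρ),
      Metric.ball p ρ, Metric.isOpen_ball, le_rfl, h⟩

end Attraction

/-! ### From finite time to all time. -/

section LongTime

variable {E : Type*} [NormedAddCommGroup E] [NormedSpace ℝ E]
  {f : ℝ → E → ℝ → E} {T ε₀ M : ℝ} {L : NNReal}

theorem half_pow_le_two_mul_exp {i : ℕ} {s : ℝ} (h : s ≤ i + 1) :
    (1 / 2 : ℝ) ^ i ≤ 2 * Real.exp (-(Real.log 2 * s)) := by
  have h2 : (1 / 2 : ℝ) ^ (i + 1) = Real.exp (-(Real.log 2 * (i + 1))) := by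
    rw [Real.exp_neg, mul_comm, ← Nat.cast_succ, Real.exp_nat_mul, Real.exp_log two_pos,
      one_div, inv_pow]
  have h3 : Real.exp (-(Real.log 2 * (i + 1))) ≤ Real.exp (-(Real.log 2 * s)) :=
    Real.exp_le_exp.2 (neg_le_neg (mul_le_mul_of_nonneg_left h (Real.log_pos one_lt_two).le))
  rw [← h2, pow_succ] at h3
  linarith

/-- A sequence which grows boundedly for `m` steps, and from then on contracts by the factor `1/2`
up to an error as long as it is small, decays geometrically up to a multiple of the error. -/
theorem geometric_decay_of_step {d : ℕ → ℝ} {m : ℕ} {r D e : ℝ} (hd0 : 0 ≤ D) (he : 0 ≤ e)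
    (hr : D + 3 * e < r) (hinit : ∀ i ≤ m, d i ≤ D + e)
    (hstep : ∀ i, m ≤ i → d i < r → d (i + 1) ≤ 1 / 2 * d i + e) (i : ℕ) :
    d i ≤ 2 ^ m * (1 / 2) ^ i * D + 3 * e := by
  -- The invariant is at most `D + 3 e < r`, so the contraction hypothesis remains available at
  -- every step.
  have key : ∀ j, d (m + j) ≤ (1 / 2) ^ j * (D + e) + 2 * e := by
    intro j
    induction j with
    | zero => simpa using (hinit m le_rfl).trans (by linarith)
    | succ j ih =>
      have h1 : ((1 : ℝ) / 2) ^ j ≤ 1 := pow_le_one₀ (by norm_num) (by norm_num)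
      have h2 : ((1 : ℝ) / 2) ^ j * (D + e) ≤ 1 * (D + e) := by gcongr
      have h3 := hstep (m + j) (Nat.le_add_right _ _) (by linarith)
      rw [← add_assoc, pow_succ]
      linarith
  rcases le_total i m with h | h
  · have h1 : (1 : ℝ) ≤ 2 ^ m * (1 / 2) ^ i := by
      obtain ⟨j, rfl⟩ := Nat.exists_eq_add_of_le h
      rw [pow_add, mul_right_comm, ← mul_pow]
      norm_num
      exact one_le_pow₀ one_le_two
    have h2 := le_mul_of_one_le_left hd0 h1
    linarith [hinit i h]
  · obtain ⟨j, rfl⟩ := Nat.exists_eq_add_of_le h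
    have h1 : (2 : ℝ) ^ m * (1 / 2) ^ (m + j) = (1 / 2) ^ j := by
      rw [pow_add, ← mul_assoc, ← mul_pow]; norm_num
    have h2 : ((1 : ℝ) / 2) ^ j ≤ 1 := pow_le_one₀ (by norm_num) (by norm_num)
    have h3 : ((1 : ℝ) / 2) ^ j * e ≤ 1 * e := by gcongr
    rw [h1]
    linarith [key j]

/-- Sample `x - z` at multiples of a window `W` with `ε W` in `[S, S + T]`. Finite-time averaging
covers the first `m` windows, after which `z` is near the origin. From then on each window halves
the difference and adds an error `C₁ (ε + δ)`. -/
theorem IsUniform.exists_long_time_bound [CompleteSpace E] (h : IsUniform f T ε₀ L M)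
    (hT : 0 < T) {S r : ℝ} (hS : 0 < S) (hr : 0 < r)
    (hcontr : ∀ p q y z, ‖p‖ < r → ‖q‖ < r →
      IsSolution univ (fun _ => PeriodicAveraging.averagedField f T) p y →
      IsSolution univ (fun _ => PeriodicAveraging.averagedField f T) q z →
      ∀ t ∈ Icc S (S + T), ‖y t - z t‖ ≤ 1 / 2 * ‖p - q‖) {C γ : ℝ} (hγ : 0 < γ) :
    ∃ k > (0 : ℝ), ∃ lam > (0 : ℝ), ∃ β > (0 : ℝ), ∃ μ > (0 : ℝ), ∃ s > (0 : ℝ),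
      ∀ (ε δ : ℝ) (g : ℝ → E) (x₀ z₀ : E) (x z : ℝ → E), ε ∈ Ioc 0 ε₀ → ε ≤ s → δ ≤ s →
      (∀ t, 0 ≤ t → ‖g t‖ ≤ δ) → ‖x₀ - z₀‖ ≤ μ →
      IsSolution univ (fun t y => ε • f t y ε + ε • g t) x₀ x →
      IsSolution univ (fun _ y => ε • PeriodicAveraging.averagedField f T y) z₀ z →
      (∀ t, 0 ≤ t → ‖z t‖ ≤ C * Real.exp (-γ * (ε * t))) →
      ∀ t, 0 ≤ t → ‖x t - z t‖ ≤ k * Real.exp (-lam * ε * t) * ‖x₀ - z₀‖ + β * (ε + δ) := by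
  have hlimC : Tendsto (fun m : ℕ => max C 0 * Real.exp (-(γ * S) * m)) atTop (𝓝 (max C 0 * 0)) := by
    refine Tendsto.const_mul _ (Real.tendsto_exp_atBot.comp ?_)
    exact tendsto_natCast_atTop_atTop.const_mul_atTop_of_neg (neg_lt_zero.2 (by positivity))
  rw [mul_zero] at hlimC
  obtain ⟨m, hm⟩ := (hlimC.eventually_lt_const (half_pos hr)).exists
  set R : ℝ := (m + 1) * (S + T)
  have hR : 0 ≤ R := by positivity
  have hSTR : S + T ≤ R := le_mul_of_one_le_left (by positivity) (by linarith [m.cast_nonneg (α := ℝ)])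
  obtain ⟨C₁, hC₁, hfin⟩ := h.exists_norm_sub_le hT hR
  set Q : ℝ := Real.exp (L * R)
  have hQ : 0 < Q := Real.exp_pos _
  have hlog : 0 < Real.log 2 := Real.log_pos one_lt_two
  -- In the first constant, one `Q` comes from the initial windows and one from the final incomplete
  -- window, `2 ^ m` from the delay before contraction starts, and `2` from rounding the number of
  -- windows. The choices of `μ` and `s` give `D ≤ r / 8` and `e ≤ r / 16`, so `D + 3 e < r / 2`.
  refine ⟨2 * Q ^ 2 * 2 ^ m, by positivity, Real.log 2 / (S + T), by positivity,
    (3 * Q + 1) * C₁, by positivity, r / (8 * Q), by positivity, min 1 (r / (32 * C₁)),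
    by positivity, ?_⟩
  intro ε δ g x₀ z₀ x z hε hεs hδs hg hxz hx hz hzd t ht
  have hε0 := hε.1
  have hεI : ε ∈ Icc 0 ε₀ := ⟨hε.1.le, hε.2⟩
  have hε1 : ε ≤ 1 := hεs.trans (min_le_left _ _)
  have hδ1 : δ ≤ 1 := hδs.trans (min_le_left _ _)
  have hδ0 : 0 ≤ δ := (norm_nonneg _).trans (hg 0 le_rfl)
  -- A window must be a whole number of periods for the shifted equation to have the same `f`.
  -- Rounding up costs at most `ε T ≤ T` of slow time, which is why contraction was established on
  -- all of `[S, S + T]`.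
  set N := ⌈S / (ε * T)⌉₊
  set W : ℝ := N * T
  have hN1 : S ≤ ε * W := by
    have := (div_le_iff₀ (by positivity)).1 (Nat.le_ceil (S / (ε * T)))
    calc S ≤ N * (ε * T) := this
      _ = ε * W := by ring
  have hN2 : ε * W ≤ S + T := by
    have h1 := (Nat.ceil_lt_add_one (show 0 ≤ S / (ε * T) by positivity)).le
    calc ε * W = N * (ε * T) := by ring
      _ ≤ (S / (ε * T) + 1) * (ε * T) := by gcongr
      _ = S + ε * T := by field_simp
      _ ≤ S + T := by
        have := mul_le_mul_of_nonneg_right hε1 hT.le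
        linarith
  have hW : 0 < W := by
    by_contra hcon
    have := mul_nonpos_of_nonneg_of_nonpos hε0.le (not_lt.1 hcon)
    linarith
  set e := C₁ * (ε + δ)
  have he : 0 ≤ e := by positivity
  have he' : 16 * e ≤ r := by
    have h1 : ε ≤ r / (32 * C₁) := hεs.trans (min_le_right _ _)
    have h2 : δ ≤ r / (32 * C₁) := hδs.trans (min_le_right _ _)
    rw [le_div_iff₀ (by positivity)] at h1 h2
    simp only [e]
    linarith
  have hF := h.averagedField hT
  have hxi : ∀ i : ℕ, IsSolution univ (fun t y => ε • f t y ε + ε • g (t + i * W)) (x (i * W))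
      (fun t => x (t + i * W)) := by
    intro i
    have := h.shift_periods hT hεI hx (i * N)
    have e1 : ((i * N : ℕ) : ℝ) * T = i * W := by push_cast; ring
    simpa only [e1] using this
  have hzi : ∀ i : ℕ, IsSolution univ (fun _ y => ε • PeriodicAveraging.averagedField f T y)
      (z (i * W)) (fun t => z (t + i * W)) := fun i => hz.shift (a := i * W) (by positivity)
  have hgi : ∀ i : ℕ, ∀ t, 0 ≤ t → ‖g (t + i * W)‖ ≤ δ := fun i t ht => hg _ (by positivity)
  set d : ℕ → ℝ := fun i => ‖x (i * W) - z (i * W)‖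
  have hinit : ∀ i ≤ m, d i ≤ Q * ‖x₀ - z₀‖ + e := by
    intro i hi
    refine hfin ε δ g x₀ z₀ x z hεI hδ1 hg hx hz (i * W) (by positivity) ?_
    have hi' : (i : ℝ) ≤ m + 1 := by have : (i : ℝ) ≤ m := by exact_mod_cast hi
                                     linarith
    calc ε * (i * W) = i * (ε * W) := by ring
      _ ≤ (m + 1) * (S + T) := by gcongr
  have hzsmall : ∀ i : ℕ, m ≤ i → ‖z (i * W)‖ < r / 2 := by
    intro i hi
    have hi' : (m : ℝ) ≤ i := by exact_mod_cast hi
    refine lt_of_le_of_lt ?_ hm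
    refine (hzd (i * W) (by positivity)).trans ?_
    refine mul_le_mul (le_max_left _ _) (Real.exp_le_exp.2 ?_) (Real.exp_pos _).le
      (le_max_right _ _)
    have : S * m ≤ ε * W * i := by gcongr
    have := mul_le_mul_of_nonneg_left this hγ.le
    linarith
  have hstep : ∀ i, m ≤ i → d i < r / 2 → d (i + 1) ≤ 1 / 2 * d i + e := by
    intro i hi hdi
    have hzs := hzsmall i hi
    have hxs : ‖x (i * W)‖ < r := by
      have := norm_sub_norm_le (x (i * W)) (z (i * W))
      linarith
    -- The averaged flow is restarted at the current value of `x`. It differs from `x` only by the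
    -- finite-time error with no initial gap, and from `z` by the contracted distance.
    obtain ⟨y, hy⟩ := exists_isSolution_of_lipschitz
      (H := fun _ => PeriodicAveraging.averagedField f T)
      (fun _ _ => h.averagedField_lipschitz hT) (fun _ _ => h.averagedField_bound hT)
      (fun _ => continuousOn_const) (x (i * W))
    have hy' := hy.rescale (a := ε) hε0.le
    have h1 := hfin ε δ _ _ _ _ _ hεI hδ1 (hgi i) (hxi i) hy' W hW.le (hN2.trans hSTR)
    rw [sub_self, norm_zero, mul_zero, zero_add] at h1
    have hz1 := (hzi i).rescale (F := fun y => ε • PeriodicAveraging.averagedField f T y)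
      (a := ε⁻¹) (by positivity)
    simp only [smul_smul, inv_mul_cancel₀ hε0.ne', one_smul] at hz1
    have h2 := hcontr _ _ _ _ hxs (by linarith) hy hz1 (ε * W) ⟨hN1, hN2⟩
    rw [inv_mul_cancel_left₀ hε0.ne'] at h2
    have e1 : ((i + 1 : ℕ) : ℝ) * W = W + i * W := by push_cast; ring
    simp only [d, e1]
    calc _ ≤ ‖x (W + i * W) - y (ε * W)‖ + ‖y (ε * W) - z (W + i * W)‖ := norm_sub_le_norm_sub_add_norm_sub _ _ _
      _ ≤ _ := by linarith
  have hQμ : Q * ‖x₀ - z₀‖ ≤ r / 8 := by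
    rw [le_div_iff₀ (by positivity)] at hxz
    linarith
  have hgeo := geometric_decay_of_step (d := d) (m := m) (r := r / 2) (D := Q * ‖x₀ - z₀‖) (e := e)
    (by positivity) he (by linarith) hinit hstep
  set i := ⌊t / W⌋₊
  have hi1 : i * W ≤ t := (le_div_iff₀ hW).1 (Nat.floor_le (by positivity))
  have hi2 : t / W < i + 1 := Nat.lt_floor_add_one (t / W)
  have hi3 : t - i * W ≤ W := by
    have := (div_lt_iff₀ hW).1 hi2
    linarith
  have h1 := hfin ε δ _ _ _ _ _ hεI hδ1 (hgi i) (hxi i) (hzi i) (t - i * W) (by linarith)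
    ((mul_le_mul_of_nonneg_left hi3 hε0.le).trans (hN2.trans hSTR))
  simp only [sub_add_cancel] at h1
  have h2 : ε * t / (S + T) ≤ i + 1 := by
    refine le_trans ?_ hi2.le
    rw [div_le_div_iff₀ (by positivity) hW]
    calc ε * t * W = t * (ε * W) := by ring
      _ ≤ t * (S + T) := by gcongr
  have h3 := half_pow_le_two_mul_exp h2
  have e3 : -(Real.log 2 * (ε * t / (S + T))) = -(Real.log 2 / (S + T)) * ε * t := by ring
  rw [e3] at h3
  calc ‖x t - z t‖ ≤ Q * d i + e := h1
    _ ≤ Q * (2 ^ m * (1 / 2) ^ i * (Q * ‖x₀ - z₀‖) + 3 * e) + e := by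
      gcongr
      exact hgeo i
    _ ≤ Q * (2 ^ m * (2 * Real.exp (-(Real.log 2 / (S + T)) * ε * t)) * (Q * ‖x₀ - z₀‖) + 3 * e)
        + e := by gcongr
    _ = _ := by simp only [e]; ring

end LongTime

/-! ### Localisation and conclusion. -/

section Main

variable {E : Type*} [NormedAddCommGroup E] [NormedSpace ℝ E] [FiniteDimensional ℝ E]
  {f : ℝ → E → ℝ → E} {T ε₀ ε δ : ℝ} {U : Set E}

theorem exists_lipschitzOnWith_perturbed (hU : IsOpen U) (hf : HasBoundedC1Data U ε₀ f)
    (hper : ∀ t ∈ Ici (0 : ℝ), ∀ x ∈ U, ∀ ε ∈ Icc 0 ε₀, f (t + T) x ε = f t x ε)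
    (hε : ε ∈ Icc 0 ε₀) (g : ℝ → E) (K : Set E) (hKU : K ⊆ U) (hK : IsCompact K) :
    ∃ L : NNReal, ∀ t, 0 ≤ t → LipschitzOnWith L (fun y => ε • f t y ε + ε • g t) K := by
  obtain ⟨G, L, M, hG, hGf⟩ := exists_isUniform_eqOn hU (hε.1.trans hε.2) hf hper hK hKU
  refine ⟨‖ε‖₊ * L, fun t ht => LipschitzOnWith.of_dist_le_mul fun a ha b hb => ?_⟩
  rw [dist_add_right, dist_smul₀, ← hGf t ht a ha ε hε, ← hGf t ht b hb ε hε, NNReal.coe_mul,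
    coe_nnnorm, mul_assoc]
  exact mul_le_mul_of_nonneg_left ((hG.lip t ht ε hε).dist_le_mul a b) (norm_nonneg _)

theorem exists_lipschitzOnWith_averagedField (hU : IsOpen U) (hT : 0 < T) (hε₀ : 0 ≤ ε₀)
    (hf : HasBoundedC1Data U ε₀ f)
    (hper : ∀ t ∈ Ici (0 : ℝ), ∀ x ∈ U, ∀ ε ∈ Icc 0 ε₀, f (t + T) x ε = f t x ε)
    (ε : ℝ) (K : Set E) (hKU : K ⊆ U) (hK : IsCompact K) :
    ∃ L : NNReal, ∀ t : ℝ, 0 ≤ t → LipschitzOnWith L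
      ((fun _ y => ε • averagedField f T y : ℝ → E → E) t) K := by
  obtain ⟨G, L, M, hG, hGf⟩ := exists_isUniform_eqOn hU hε₀ hf hper hK hKU
  have hav : ∀ y ∈ K, averagedField G T y = averagedField f T y := fun y hy =>
    averagedField_congr hT fun t ht => hGf t ht y hy 0 ⟨le_rfl, hε₀⟩
  refine ⟨‖ε‖₊ * L, fun t ht => LipschitzOnWith.of_dist_le_mul fun a ha b hb => ?_⟩
  rw [dist_smul₀, ← hav a ha, ← hav b hb, NNReal.coe_mul, coe_nnnorm, mul_assoc]
  exact mul_le_mul_of_nonneg_left ((hG.averagedField_lipschitz hT).dist_le_mul a b) (norm_nonneg _)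

/-- The estimates are proved for a cutoff field agreeing with `f` on a compact neighbourhood of all
relevant averaged trajectories and on a ball about the origin. They then show that the perturbed
solution never leaves that region. -/
theorem exists_averaging_bound (hU : IsOpen U) (hε₀ : 0 < ε₀) (hT : 0 < T)
    (hf : HasBoundedC1Data U ε₀ f)
    (hper : ∀ t ∈ Ici (0 : ℝ), ∀ x ∈ U, ∀ ε ∈ Icc 0 ε₀, f (t + T) x ε = f t x ε)
    (hstab : IsExpStableOrigin U (averagedField f T))
    {Ω : Set E} (hΩ : IsCompact Ω) (hΩattr : Ω ⊆ regionOfAttraction U (averagedField f T)) :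
    ∃ k > (0 : ℝ), ∃ lam > (0 : ℝ), ∃ β > (0 : ℝ), ∃ μ > (0 : ℝ), ∃ s > (0 : ℝ),
      ∀ (ε δ : ℝ) (g : ℝ → E) (x₀ z₀ : E), ε ∈ Ioc 0 ε₀ → ε ≤ s → δ ≤ s →
      ContinuousOn g (Ici 0) → (∀ t, 0 ≤ t → ‖g t‖ ≤ δ) → x₀ ∈ Ω → ‖x₀ - z₀‖ ≤ μ →
      ∃ x z, IsSolution U (fun t y => ε • f t y ε + ε • g t) x₀ x ∧
        IsSolution U (fun _ y => ε • averagedField f T y) z₀ z ∧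
        ∀ t, 0 ≤ t → ‖x t - z t‖ ≤ k * Real.exp (-lam * ε * t) * ‖x₀ - z₀‖ + β * (ε + δ) := by
  have : ProperSpace E := FiniteDimensional.proper ℝ E
  have : CompleteSpace E := FiniteDimensional.complete ℝ E
  set F := averagedField f T
  obtain ⟨h0U, hF0, c, hc, K₀, hK₀, γ, hγ, hdecay⟩ := hstab
  have hzI : (0 : ℝ) ∈ Icc 0 ε₀ := ⟨le_rfl, hε₀.le⟩
  have hext : ∀ K ⊆ U, IsCompact K → ∃ (G : E → E) (L : NNReal) (M : ℝ),
      LipschitzWith L G ∧ (∀ x, ‖G x‖ ≤ M) ∧ EqOn G F K := by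
    intro K hKU hK
    obtain ⟨G, L, M, hG, hGf⟩ := exists_isUniform_eqOn hU hε₀.le hf hper hK hKU
    exact ⟨averagedField G T, L, M, hG.averagedField_lipschitz hT, hG.averagedField_bound hT,
      fun y hy => averagedField_congr hT fun t ht => hGf t ht y hy 0 hzI⟩
  obtain ⟨O, hO, hΩO, K₁, hK₁U, hK₁, C, hOsol⟩ :=
    exists_open_uniform_decay hU h0U hext hc hK₀ hγ hdecay hΩ hΩattr
  obtain ⟨ρ, hρ, hρU⟩ := hK₁.exists_cthickening_subset_open hU hK₁U
  obtain ⟨r₁, hr₁, hball⟩ := Metric.nhds_basis_closedBall.mem_iff.1 (hU.mem_nhds h0U)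
  obtain ⟨μ₁, hμ₁, hμO⟩ := hΩ.exists_thickening_subset_open hO hΩO
  set K := Metric.cthickening ρ K₁ ∪ Metric.closedBall 0 r₁
  have hKU : K ⊆ U := union_subset hρU hball
  have hK : IsCompact K := hK₁.cthickening.union (isCompact_closedBall 0 r₁)
  have hK₁K : K₁ ⊆ K := (Metric.self_subset_cthickening K₁).trans subset_union_left
  obtain ⟨G, L, M, hG, hGf⟩ := exists_isUniform_eqOn hU hε₀.le hf hper hK hKU
  have hGF : ∀ y ∈ K, averagedField G T y = F y := fun y hy =>
    averagedField_congr hT fun t ht => hGf t ht y hy 0 hzI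
  have hbK : ∀ y : E, ‖y‖ ≤ r₁ → y ∈ K := fun y hy => .inr (by simpa using hy)
  have hGL : ∀ t : ℝ, 0 ≤ t → LipschitzWith L ((fun _ => averagedField G T : ℝ → E → E) t) :=
    fun _ _ => hG.averagedField_lipschitz hT
  obtain ⟨A, hA⟩ := exists_strict_approx_averagedField hU h0U hT hε₀.le hf
  obtain ⟨S, hS, r, hr, hcontr⟩ := exists_flow_contraction (hG.averagedField_lipschitz hT)
    (hG.averagedField_bound hT) ((hGF 0 (hbK 0 (by simpa using hr₁.le))).trans hF0) (A := A)
    (fun η hη => by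
      obtain ⟨r, hr, hAr⟩ := hA η hη
      refine ⟨min r r₁, by positivity, fun a b ha hb => ?_⟩
      rw [hGF a (hbK a (ha.le.trans (min_le_right _ _))),
        hGF b (hbK b (hb.le.trans (min_le_right _ _)))]
      exact hAr a b (ha.trans_le (min_le_left _ _)) (hb.trans_le (min_le_left _ _)))
    (c := min c (r₁ / K₀)) (K := K₀) (γ := γ) (T := T) (by positivity) hK₀ hγ hT
    (fun p z hp hz t ht => by
      obtain ⟨ζ, hζ, hζd⟩ := hdecay p (hp.trans_le (min_le_left _ _))
      have hp' : K₀ * ‖p‖ ≤ r₁ := by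
        have := (le_div_iff₀ hK₀).1 (hp.trans_le (min_le_right _ _)).le
        linarith
      have hζG : IsSolution univ (fun _ => averagedField G T) p ζ := by
        refine hζ.congr_field (fun _ _ => trivial) fun t ht => (hGF _ (hbK _ ?_)).symm
        refine (hζd t ht).trans (le_trans (mul_le_of_le_one_right (by positivity) ?_) hp')
        exact Real.exp_le_one_iff.2 (by rw [neg_mul]; exact neg_nonpos.2 (by positivity))
      rw [IsSolution.unique_of_lipschitz hGL hz hζG ht]
      exact hζd t ht)
  obtain ⟨k, hk, lam, hlam, β, hβ, μ, hμ, s, hs, hmain⟩ :=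
    hG.exists_long_time_bound hT hS hr hcontr (C := C) hγ
  -- `μ₁ / 2` puts `z₀` in `O`, and `ρ / (2 β)` makes `β (ε + δ) ≤ ρ`.
  refine ⟨k, hk, lam, hlam, β, hβ, min μ (μ₁ / 2), by positivity, min s (ρ / (2 * β)),
    by positivity, ?_⟩
  intro ε δ g x₀ z₀ hε hεs hδs hgc hg hx₀ hxz
  have hεI : ε ∈ Icc 0 ε₀ := ⟨hε.1.le, hε.2⟩
  have avsol : ∀ q ∈ O, ∃ z, IsSolution U (fun _ y => ε • F y) q z ∧ (∀ t, 0 ≤ t → z t ∈ K₁) ∧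
      IsSolution univ (fun _ y => ε • averagedField G T y) q z ∧
      ∀ t, 0 ≤ t → ‖z t‖ ≤ C * Real.exp (-γ * (ε * t)) := by
    intro q hq
    obtain ⟨z, hz, hzK, hzd⟩ := hOsol q hq
    have hεt : ∀ t, 0 ≤ t → 0 ≤ ε * t := fun t ht => mul_nonneg hεI.1 ht
    refine ⟨fun t => z (ε * t), hz.rescale hεI.1, fun t ht => hzK _ (hεt t ht), ?_,
      fun t ht => hzd _ (hεt t ht)⟩
    refine (hz.rescale hεI.1).congr_field (fun _ _ => trivial) fun t ht => ?_
    rw [hGF _ (hK₁K (hzK _ (hεt t ht)))]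
  have hz₀O : z₀ ∈ O := by
    refine hμO (Metric.mem_thickening_iff.2 ⟨x₀, hx₀, ?_⟩)
    rw [dist_comm, dist_eq_norm]
    linarith [hxz.trans (min_le_right _ _)]
  obtain ⟨z, hzU, -, hzG, hzd⟩ := avsol z₀ hz₀O
  obtain ⟨w, -, hwK, hwG, hwd⟩ := avsol x₀ (hΩO hx₀)
  obtain ⟨x, hx⟩ := exists_isSolution_of_lipschitz (H := fun t y => ε • G t y ε + ε • g t)
    (L := ‖ε‖₊ * L) (M := ‖ε‖ * (M + δ))
    (fun t ht => LipschitzWith.of_dist_le_mul fun a b => by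
      rw [dist_add_right, dist_smul₀, NNReal.coe_mul, coe_nnnorm, mul_assoc]
      exact mul_le_mul_of_nonneg_left ((hG.lip t ht ε hεI).dist_le_mul a b) (norm_nonneg _))
    (fun t ht y => by
      rw [← smul_add, norm_smul]
      exact mul_le_mul_of_nonneg_left ((norm_add_le _ _).trans
        (add_le_add (hG.bound t ht y ε hεI) (hg t ht))) (norm_nonneg _))
    (fun y => (continuousOn_const.smul (hG.cont y ε hεI)).add (continuousOn_const.smul hgc)) x₀
  have hεs' := hεs.trans (min_le_left _ _)
  have hδs' := hδs.trans (min_le_left _ _)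
  have hxK : ∀ t, 0 ≤ t → x t ∈ K := by
    intro t ht
    -- Comparing with the averaged solution from `x₀` itself removes the initial gap, so `x` stays
    -- within `ρ` of `K₁` whatever `z₀` is.
    have h1 := hmain ε δ g x₀ x₀ x w hε hεs' hδs' hg (by simpa using hμ.le) hx hwG hwd t ht
    rw [sub_self, norm_zero, mul_zero, zero_add] at h1
    have h2 := hεs.trans (min_le_right _ _)
    have h3 := hδs.trans (min_le_right _ _)
    rw [le_div_iff₀ (by positivity)] at h2 h3
    refine .inl (Metric.mem_cthickening_of_dist_le _ (w t) _ _ (hwK t ht) ?_)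
    rw [dist_eq_norm]
    linarith
  refine ⟨x, z, hx.congr_field (fun t ht => hKU (hxK t ht)) fun t ht => ?_, hzU, ?_⟩
  · simp only [hGf t ht _ (hxK t ht) ε hεI]
  · exact hmain ε δ g x₀ z₀ x z hε hεs' hδs' hg (hxz.trans (min_le_left _ _)) hx hzG hzd

end Main

end PeriodicAveraging

theorem mainTheorem3 (n : ℕ) (U : Set (EuclideanSpace ℝ (Fin n))) (hU : IsOpen U)
    (ε₀ : ℝ) (hε₀ : 0 < ε₀) (T : ℝ) (hT : 0 < T)
    (f : ℝ → EuclideanSpace ℝ (Fin n) → ℝ → EuclideanSpace ℝ (Fin n))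
    (hf : PeriodicAveraging.HasBoundedC1Data U ε₀ f)
    (hper : ∀ t ∈ Ici (0 : ℝ), ∀ x ∈ U, ∀ ε ∈ Icc 0 ε₀, f (t + T) x ε = f t x ε)
    -- stability and attraction for `z' = ε₁ f_av(z)`, for some one value `ε₁ > 0`
    (ε₁ : ℝ) (hε₁ : 0 < ε₁)
    (hstab : PeriodicAveraging.IsExpStableOrigin U
      (fun z => ε₁ • PeriodicAveraging.averagedField f T z))
    (Ω : Set (EuclideanSpace ℝ (Fin n))) (hΩ : IsCompact Ω)
    (hΩattr : Ω ⊆ PeriodicAveraging.regionOfAttraction U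
      (fun z => ε₁ • PeriodicAveraging.averagedField f T z)) :
    ∃ k > (0 : ℝ), ∃ lam > (0 : ℝ), ∃ δs > (0 : ℝ), ∃ εs > (0 : ℝ), ∃ β₁ > (0 : ℝ),
      ∃ β₂ > (0 : ℝ), ∃ μ > (0 : ℝ), εs ≤ ε₀ ∧
      ∀ ε ∈ Ioo 0 εs, ∀ δ ∈ Ioo 0 δs,
      ∀ g : ℝ → EuclideanSpace ℝ (Fin n), ContinuousOn g (Ici 0) →
      (∀ t ∈ Ici (0 : ℝ), ‖g t‖ ≤ δ) →
      ∀ x₀ ∈ Ω, ∀ z₀ : EuclideanSpace ℝ (Fin n), ‖x₀ - z₀‖ ≤ μ →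
        (∃ x, PeriodicAveraging.IsSolution U (fun t y => ε • f t y ε + ε • g t) x₀ x) ∧
        (∃ z, PeriodicAveraging.IsSolution U
          (fun _ y => ε • PeriodicAveraging.averagedField f T y) z₀ z) ∧
        ∀ x z : ℝ → EuclideanSpace ℝ (Fin n),
          PeriodicAveraging.IsSolution U (fun t y => ε • f t y ε + ε • g t) x₀ x →
          PeriodicAveraging.IsSolution U
            (fun _ y => ε • PeriodicAveraging.averagedField f T y) z₀ z →
          ∀ t ∈ Ici (0 : ℝ),
            ‖x t - z t‖ ≤ k * Real.exp (-lam * ε * t) * ‖x₀ - z₀‖ + β₁ * ε + β₂ * δ := by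
  obtain ⟨k, hk, lam, hlam, β, hβ, μ, hμ, s, hs, h⟩ :=
    PeriodicAveraging.exists_averaging_bound hU hε₀ hT hf hper (hstab.of_smul hε₁) hΩ
      (hΩattr.trans (PeriodicAveraging.regionOfAttraction_smul_subset hε₁))
  refine ⟨k, hk, lam, hlam, s, hs, min s ε₀, by positivity, β, hβ, β, hβ, μ, hμ,
    min_le_right _ _, ?_⟩
  intro ε hε δ hδ g hgc hg x₀ hx₀ z₀ hxz
  have hεI : ε ∈ Ioc 0 ε₀ := ⟨hε.1, hε.2.le.trans (min_le_right _ _)⟩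
  obtain ⟨x, z, hx, hz, hb⟩ := h ε δ g x₀ z₀ hεI (hε.2.le.trans (min_le_left _ _)) hδ.2.le
    hgc hg hx₀ hxz
  refine ⟨⟨x, hx⟩, ⟨z, hz⟩, fun x' z' hx' hz' t ht => ?_⟩
  -- Arbitrary solutions in `U` coincide with the constructed ones, as both fields are Lipschitz on
  -- compact subsets of `U` uniformly in time.
  rw [hx'.unique (PeriodicAveraging.exists_lipschitzOnWith_perturbed hU hf hper
      (Ioc_subset_Icc_self hεI) g) hx ht,
    hz'.unique (PeriodicAveraging.exists_lipschitzOnWith_averagedField hU hT hε₀.le hf hper ε)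
      hz ht]
  exact (hb t ht).trans (le_of_eq (by ring))
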